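/- **Theorem (K-Theorem).** Let $(\tilde M,\tilde g)$ be a four-dimensional space-time, i.e. a smooth manifold with a continuous Lorentzian metric of signature $(-,+,+,+)$ and a time orientation. Let $T$ be a smooth cosmic time function on $\tilde M$, i.e. a smooth function that increases along every future-directed causal curve and has everywhere timelike gradient, and suppose that $\tilde g$ is (non-degenerate and) at least $C^2$ on an open neighbourhood of the slice $\{T=0\}$. Let $g=\Omega^2(T)\,\tilde g$ be the conformally rescaled metric on $M=\{T<0\}$ in cases (i), (ii), and on $M=\{T>0\}$ in cases (iii), (iv), near $T=0$, where the real function $\Omega$ satisfies one of the following conditions for some $c>0$: 1. (i) $T\to0^-$, $\lim_{t\to0^-}\Omega(t)=+\infty$, and $\Omega$ is positive, $C^2$ and strictly increasing on $[-c,0)$; 2. (ii) $T\to0^-$, $\Omega(0)=0$, and $\Omega$ is positive, $C^2$ and strictly decreasing on $[-c,0)$ and continuous on $[-c,0]$; 3. (iii) $T\to0^+$, $\lim_{t\to0^+}\Omega(t)=+\infty$, and $\Omega$ is positive, $C^2$ and strictly decreasing on $(0,c]$; 4. (iv) $T\to0^+$, $\Omega(0)=0$, and $\Omega$ is positive, $C^2$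 and strictly increasing on $(0,c]$ and continuous on $[0,c]$. Put $L=\Omega''\Omega/(\Omega')^2$ and suppose that $\lambda=\lim_{t\to0^\pm}L(t)$ (with the sign of the case at hand) exists in $[-\infty,+\infty]$ and $\lambda\neq1$. Let $$K=\frac{C_{abcd}C^{abcd}}{R_{ab}R^{ab}},$$ where $C_{abcd}$ and $R_{ab}$ are the Weyl and Ricci tensors of $g$. Then $\lim_{T\to0^\pm}K=0$ in the following sense: for every point $p_0$ with $T(p_0)=0$, $R_{ab}R^{ab}\neq0$ at all points of $M$ sufficiently close to $p_0$, and $K(p)\to0$ as $p\to p_0$ within $M$ (the scalars may be computed in any smooth chart around $p_0$). -/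

import Mathlib

open Set Filter Topology
open scoped Manifold ContDiff

noncomputable section

namespace ConformalCosmology

/-! ### Curvature of a metric given by its components in coordinates

Everything in this part lives in the coordinate space `ℝ⁴`; a metric is given by its matrix of
components `G x i j`. -/

/-- The coordinate space `ℝ⁴`. -/
abbrev Coord : Type := EuclideanSpace ℝ (Fin 4)

/-- The `i`-th coordinate direction. -/
abbrev coordDir (i : Fin 4) : Coord := EuclideanSpace.single i (1 : ℝ)

/-- The partial derivative `∂ᵢ f` at `x`. -/
def pd (i : Fin 4) (f : Coord → ℝ) (x : Coord) : ℝ := fderiv ℝ f x (coordDir i)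

/-- The inverse metric `g^{ij}`. -/
def invMetric (G : Coord → Matrix (Fin 4) (Fin 4) ℝ) (x : Coord) : Matrix (Fin 4) (Fin 4) ℝ :=
  (G x)⁻¹

/-- Christoffel symbols `Γ^a_{bc} = ½ g^{ad} (∂_b g_{dc} + ∂_c g_{db} - ∂_d g_{bc})`. -/
def christoffel (G : Coord → Matrix (Fin 4) (Fin 4) ℝ) (a b c : Fin 4) (x : Coord) : ℝ :=
  (1 / 2 : ℝ) * ∑ d, invMetric G x a d *
    (pd b (fun y => G y d c) x + pd c (fun y => G y d b) x - pd d (fun y => G y b c) x)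

/-- Riemann tensor
`R^a_{bcd} = ∂_c Γ^a_{db} - ∂_d Γ^a_{cb} + Γ^a_{ce} Γ^e_{db} - Γ^a_{de} Γ^e_{cb}`. -/
def riemannUp (G : Coord → Matrix (Fin 4) (Fin 4) ℝ) (a b c d : Fin 4) (x : Coord) : ℝ :=
  pd c (christoffel G a d b) x - pd d (christoffel G a c b) x
    + ∑ e, (christoffel G a c e x * christoffel G e d b x
            - christoffel G a d e x * christoffel G e c b x)

/-- Riemann tensor with all indices down, `R_{abcd} = g_{ae} R^e_{bcd}`. -/
def riemann (G : Coord → Matrix (Fin 4) (Fin 4) ℝ) (a b c d : Fin 4) (x : Coord) : ℝ :=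
  ∑ e, G x a e * riemannUp G e b c d x

/-- Ricci tensor `R_{ab} = R^c_{acb}`. -/
def ricci (G : Coord → Matrix (Fin 4) (Fin 4) ℝ) (a b : Fin 4) (x : Coord) : ℝ :=
  ∑ c, riemannUp G c a c b x

/-- Scalar curvature `R = g^{ab} R_{ab}`. -/
def scalarCurv (G : Coord → Matrix (Fin 4) (Fin 4) ℝ) (x : Coord) : ℝ :=
  ∑ a, ∑ b, invMetric G x a b * ricci G a b x

/-- Weyl tensor `C_{abcd}` in dimension four. -/
def weyl (G : Coord → Matrix (Fin 4) (Fin 4) ℝ) (a b c d : Fin 4) (x : Coord) : ℝ :=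
  riemann G a b c d x
    - (1 / 2 : ℝ) * (G x a c * ricci G b d x - G x a d * ricci G b c x
        + G x b d * ricci G a c x - G x b c * ricci G a d x)
    + scalarCurv G x / 6 * (G x a c * G x b d - G x a d * G x b c)

/-- The scalar `R_{ab} R^{ab}`. -/
def ricciSq (G : Coord → Matrix (Fin 4) (Fin 4) ℝ) (x : Coord) : ℝ :=
  ∑ a, ∑ b, ∑ a', ∑ b',
    invMetric G x a a' * invMetric G x b b' * ricci G a b x * ricci G a' b' x

/-- The scalar `C_{abcd} C^{abcd}`. -/
def weylSq (G : Coord → Matrix (Fin 4) (Fin 4) ℝ) (x : Coord) : ℝ :=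
  ∑ a, ∑ b, ∑ c, ∑ d, ∑ a', ∑ b', ∑ c', ∑ d',
    invMetric G x a a' * invMetric G x b b' * invMetric G x c c' * invMetric G x d d'
      * weyl G a b c d x * weyl G a' b' c' d' x

/-! ### Metrics on four-dimensional smooth manifolds -/

section Manifold

variable (M : Type*) [TopologicalSpace M] [ChartedSpace Coord M]

/-- A field of bilinear forms on the tangent spaces, i.e. a covariant tensor field of rank two. -/
abbrev BilinField : Type _ :=
  ∀ p : M, TangentSpace (𝓡 4) p →L[ℝ] TangentSpace (𝓡 4) p →L[ℝ] ℝ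

variable {M}

/-- The components `g_{ij} = g(∂ᵢ, ∂ⱼ)` of a tensor field in the chart `φ`, as functions of the
coordinates (meaningful on `φ.target`). -/
def components (g : BilinField M) (φ : OpenPartialHomeomorph M Coord) (x : Coord) :
    Matrix (Fin 4) (Fin 4) ℝ :=
  Matrix.of fun i j =>
    g (φ.symm x) (mfderiv (𝓡 4) (𝓡 4) φ.symm x (coordDir i))
      (mfderiv (𝓡 4) (𝓡 4) φ.symm x (coordDir j))

/-- `R_{ab} R^{ab}` of the metric `g` at the point `p`, computed in the chart `φ` around `p`. -/
def ricciSqAt (g : BilinField M) (φ : OpenPartialHomeomorph M Coord) (p : M) : ℝ :=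
  ricciSq (components g φ) (φ p)

/-- `C_{abcd} C^{abcd}` of the metric `g` at the point `p`, computed in the chart `φ`
around `p`. -/
def weylSqAt (g : BilinField M) (φ : OpenPartialHomeomorph M Coord) (p : M) : ℝ :=
  weylSq (components g φ) (φ p)

/-- The scalar `K = C_{abcd} C^{abcd} / R_{ef} R^{ef}` of the metric `g` at the point `p`,
computed in the chart `φ` around `p`. -/
def scalarK (g : BilinField M) (φ : OpenPartialHomeomorph M Coord) (p : M) : ℝ :=
  weylSqAt g φ p / ricciSqAt g φ p

/-- A tensor field is of class `C^k` on the open set `U`: so are its components in every smooth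
chart. -/
def IsCkOn (k : ℕ) (g : BilinField M) (U : Set M) : Prop :=
  ∀ φ ∈ IsManifold.maximalAtlas (𝓡 4) ∞ M, ∀ i j : Fin 4,
    ContDiffOn ℝ k (fun x => components g φ x i j) (φ.target ∩ φ.symm ⁻¹' U)

variable (M) [IsManifold (𝓡 4) ∞ M]

/-- A (continuous) Lorentzian metric, of signature `(-,+,+,+)`, with a time orientation given by
a continuous timelike vector field. -/
structure SpacetimeMetric where
  /-- the metric tensor -/
  val : BilinField M
  symm : ∀ (p : M) (v w : TangentSpace (𝓡 4) p), val p v w = val p w v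
  lorentzian : ∀ p : M, ∃ e : Module.Basis (Fin 4) ℝ (TangentSpace (𝓡 4) p), ∀ i j : Fin 4,
    val p (e i) (e j) = if i = j then (if i = 0 then -1 else 1) else 0
  continuous_val : IsCkOn 0 val univ
  /-- a timelike vector field that points to the future -/
  future : ∀ p : M, TangentSpace (𝓡 4) p
  continuous_future : Continuous fun p => (⟨p, future p⟩ : TangentBundle (𝓡 4) M)
  timelike_future : ∀ p : M, val p (future p) (future p) < 0

variable {M}

/-- Future-directed causal (timelike or null, nonzero) tangent vectors. -/
def SpacetimeMetric.IsFutureCausal (g : SpacetimeMetric M) {p : M} (v : TangentSpace (𝓡 4) p) :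
    Prop :=
  v ≠ 0 ∧ g.val p v v ≤ 0 ∧ g.val p (g.future p) v < 0

/-- Future-directed causal curves `γ : [a, b] → M` of class `C¹`. -/
def SpacetimeMetric.IsFutureCausalCurve (g : SpacetimeMetric M) (γ : ℝ → M) (a b : ℝ) : Prop :=
  ContMDiffOn 𝓘(ℝ, ℝ) (𝓡 4) 1 γ (Icc a b) ∧
    ∀ t ∈ Icc a b,
      g.IsFutureCausal (mfderivWithin 𝓘(ℝ, ℝ) (𝓡 4) γ (Icc a b) t (1 : ℝ))

/-- A smooth cosmic time function: a smooth function which increases along every future-directed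
causal curve and whose gradient is everywhere timelike. -/
structure IsCosmicTime (g : SpacetimeMetric M) (T : M → ℝ) : Prop where
  smooth : ContMDiff (𝓡 4) 𝓘(ℝ, ℝ) ∞ T
  increasing : ∀ (γ : ℝ → M) (a b : ℝ), a < b → g.IsFutureCausalCurve γ a b → T (γ a) < T (γ b)
  timelike_gradient : ∀ p : M, ∃ n : TangentSpace (𝓡 4) p,
    (∀ v : TangentSpace (𝓡 4) p, g.val p n v = (mfderiv (𝓡 4) 𝓘(ℝ, ℝ) T p v : ℝ)) ∧
      g.val p n n < 0

/-- The conformally rescaled metric `Ω²(T) g`. -/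
def conformalRescaling (Ω : ℝ → ℝ) (T : M → ℝ) (g : BilinField M) : BilinField M :=
  fun p => (Ω (T p) ^ 2) • g p

end Manifold

/-! ### Conformal factors -/

/-- The function `L = Ω'' Ω / (Ω')²`. -/
def ratioL (Ω : ℝ → ℝ) (t : ℝ) : ℝ := deriv (deriv Ω) t * Ω t / (deriv Ω t) ^ 2

/-- `T → 0⁻`, `Ω(0) = ∞`, and `Ω` is positive, `C²` and strictly increasing on `[-c, 0)`. -/
def DivergesFromBelow (Ω : ℝ → ℝ) : Prop :=
  Tendsto Ω (𝓝[<] 0) atTop ∧ ∃ c : ℝ, 0 < c ∧ (∀ t ∈ Ico (-c) 0, 0 < Ω t) ∧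
    ContDiffOn ℝ 2 Ω (Ico (-c) 0) ∧ StrictMonoOn Ω (Ico (-c) 0)

/-- `T → 0⁻`, `Ω(0) = 0`, and `Ω` is positive, `C²` and strictly decreasing on `[-c, 0)` and
continuous on `[-c, 0]`. -/
def VanishesFromBelow (Ω : ℝ → ℝ) : Prop :=
  Ω 0 = 0 ∧ ∃ c : ℝ, 0 < c ∧ (∀ t ∈ Ico (-c) 0, 0 < Ω t) ∧
    ContDiffOn ℝ 2 Ω (Ico (-c) 0) ∧ StrictAntiOn Ω (Ico (-c) 0) ∧
    ContinuousOn Ω (Icc (-c) 0)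

/-- `T → 0⁺`, `Ω(0) = ∞`, and `Ω` is positive, `C²` and strictly decreasing on `(0, c]`. -/
def DivergesFromAbove (Ω : ℝ → ℝ) : Prop :=
  Tendsto Ω (𝓝[>] 0) atTop ∧ ∃ c : ℝ, 0 < c ∧ (∀ t ∈ Ioc 0 c, 0 < Ω t) ∧
    ContDiffOn ℝ 2 Ω (Ioc 0 c) ∧ StrictAntiOn Ω (Ioc 0 c)

/-- `T → 0⁺`, `Ω(0) = 0`, and `Ω` is positive, `C²` and strictly increasing on `(0, c]` and
continuous on `[0, c]`. -/
def VanishesFromAbove (Ω : ℝ → ℝ) : Prop :=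
  Ω 0 = 0 ∧ ∃ c : ℝ, 0 < c ∧ (∀ t ∈ Ioc 0 c, 0 < Ω t) ∧
    ContDiffOn ℝ 2 Ω (Ioc 0 c) ∧ StrictMonoOn Ω (Ioc 0 c) ∧
    ContinuousOn Ω (Icc 0 c)

/-- Along the filter `l` on the manifold the scalar `K` of the metric `g`, computed in the chart
`φ`, is eventually defined (its denominator does not vanish) and tends to `0`. -/
def KTendsToZero {M : Type*} [TopologicalSpace M] [ChartedSpace Coord M] (g : BilinField M)
    (φ : OpenPartialHomeomorph M Coord) (l : Filter M) : Prop :=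
  (∀ᶠ p in l, ricciSqAt g φ p ≠ 0) ∧ Tendsto (scalarK g φ) l (𝓝 0)

end ConformalCosmology

end

/-!
Write `H = Ω'/Ω` for the logarithmic derivative of the conformal factor, evaluated at `T`. In a
chart the Christoffel symbols of `Ω(T)² g` are those of `g` plus `H` times the difference tensor
`E^a_{bc} = δ^a_b ∂_c T + δ^a_c ∂_b T - g_{bc} ∇^a T`. Inserting this into the Riemann tensor, and
keeping the factor `g` apart, gives

  `Riem(Ω² g) = Riem(g) + H X + P`,

where `X` is built from `E`, its first derivatives and the connection of `g`, and is therefore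
continuous up to the slice `{T = 0}`, and `P` contains `E` undifferentiated, with coefficients `H'`
and `H²`. No covariant derivatives of `T` have to be identified, since only the size of `X` matters
(`riemannUp_conformal`).

The array `P` is of Kulkarni–Nomizu type, so its Weyl part vanishes (`weylOf_leadingRiemann`), while
the square of its Ricci part is `12 N² (H'² + H' H² + H⁴)` with `N = ⟨∇T, ∇T⟩ ≠ 0`
(`pairTwo_ricciOf_leadingRiemann`); the quadratic form is positive definite, which is why no
assumption on the size of `H'` is needed. The powers of `Ω` cancel in `K`, and so does a common
factor of the Riemann tensor. Dividing the latter by `H² + |H'|` leaves `P` bounded, with the square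
of its Ricci part bounded below, and sends the remaining terms to zero as soon as `|H| → ∞`
(`normalized_curvature_limits`, `tendsto_weylSq_div_ricciSq`).

That `|H| → ∞` is where the hypotheses on `Ω` enter (`tendsto_abs_logDeriv`). The function `1/H` has
derivative `1 - L`, whose sign is eventually constant because `λ ≠ 1`. Thus `1/H` is monotone near
`0`, and if it did not tend to zero then `H` would be bounded, hence `log Ω` as well, although `Ω`
tends to `∞` or to `0`. Strict monotonicity of `Ω` does not exclude zeros of `Ω'`, where `L` is `0`
by convention; Grönwall's inequality shows that there are none near `0`.
-/

noncomputable section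

namespace ConformalCosmology

/-! ### Curvature tensors as algebraic functions of the Riemann tensor -/

/-- The contraction `R^c_{bcd}` of an array `R^a_{bcd}`. -/
def ricciOf (R : Fin 4 → Fin 4 → Fin 4 → Fin 4 → ℝ) (b d : Fin 4) : ℝ := ∑ c, R c b c d

/-- The Weyl part of an array `R^a_{bcd}` with respect to a metric `g`; the array `h` stands for
the inverse metric. -/
def weylOf (g h : Matrix (Fin 4) (Fin 4) ℝ) (R : Fin 4 → Fin 4 → Fin 4 → Fin 4 → ℝ)
    (a b c d : Fin 4) : ℝ :=
  ∑ e, g a e * R e b c d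
    - (1 / 2 : ℝ) * (g a c * ricciOf R b d - g a d * ricciOf R b c
        + g b d * ricciOf R a c - g b c * ricciOf R a d)
    + (∑ a, ∑ b, h a b * ricciOf R a b) / 6 * (g a c * g b d - g a d * g b c)

/-- The pairing `h^{aa'} h^{bb'} A_{ab} B_{a'b'}`. -/
def pairTwo (h : Matrix (Fin 4) (Fin 4) ℝ) (A B : Fin 4 → Fin 4 → ℝ) : ℝ :=
  ∑ a, ∑ b, ∑ a', ∑ b', h a a' * h b b' * A a b * B a' b'

/-- The full contraction of an array `C_{abcd}` with itself, indices raised by `h`. -/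
def sqFour (h : Matrix (Fin 4) (Fin 4) ℝ) (C : Fin 4 → Fin 4 → Fin 4 → Fin 4 → ℝ) : ℝ :=
  ∑ a, ∑ b, ∑ c, ∑ d, ∑ a', ∑ b', ∑ c', ∑ d',
    h a a' * h b b' * h c c' * h d d' * C a b c d * C a' b' c' d'

lemma ricciSq_eq_pairTwo (G : Coord → Matrix (Fin 4) (Fin 4) ℝ) (x : Coord) :
    ricciSq G x = pairTwo (G x)⁻¹ (ricciOf fun a b c d => riemannUp G a b c d x)
      (ricciOf fun a b c d => riemannUp G a b c d x) := rfl

lemma weylSq_eq_sqFour (G : Coord → Matrix (Fin 4) (Fin 4) ℝ) (x : Coord) :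
    weylSq G x = sqFour (G x)⁻¹ (weylOf (G x) (G x)⁻¹ fun a b c d => riemannUp G a b c d x) := rfl

lemma ricciOf_add (R R' : Fin 4 → Fin 4 → Fin 4 → Fin 4 → ℝ) (b d : Fin 4) :
    ricciOf (R + R') b d = ricciOf R b d + ricciOf R' b d := by
  simp [ricciOf, Finset.sum_add_distrib]

lemma ricciOf_smul (k : ℝ) (R : Fin 4 → Fin 4 → Fin 4 → Fin 4 → ℝ) (b d : Fin 4) :
    ricciOf (k • R) b d = k * ricciOf R b d := by
  simp [ricciOf, Finset.mul_sum]

lemma weylOf_add (g h : Matrix (Fin 4) (Fin 4) ℝ) (R R' : Fin 4 → Fin 4 → Fin 4 → Fin 4 → ℝ) :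
    weylOf g h (R + R') = weylOf g h R + weylOf g h R' := by
  funext a b c d
  simp only [weylOf, ricciOf_add, Pi.add_apply, mul_add, Finset.sum_add_distrib]
  ring

lemma weylOf_smul (g h : Matrix (Fin 4) (Fin 4) ℝ) (k : ℝ)
    (R : Fin 4 → Fin 4 → Fin 4 → Fin 4 → ℝ) :
    weylOf g h (k • R) = k • weylOf g h R := by
  funext a b c d
  simp only [weylOf, ricciOf_smul, Pi.smul_apply, smul_eq_mul, mul_left_comm _ k,
    ← Finset.mul_sum]
  ring

lemma weylOf_conformal {F : ℝ} (hF : F ≠ 0) (g h : Matrix (Fin 4) (Fin 4) ℝ)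
    (R : Fin 4 → Fin 4 → Fin 4 → Fin 4 → ℝ) :
    weylOf (F • g) (F⁻¹ • h) R = F • weylOf g h R := by
  funext a b c d
  simp only [weylOf, Matrix.smul_apply, Pi.smul_apply, smul_eq_mul, mul_assoc,
    ← Finset.mul_sum]
  field_simp

lemma pairTwo_smul (h : Matrix (Fin 4) (Fin 4) ℝ) (k : ℝ) (A B : Fin 4 → Fin 4 → ℝ) :
    pairTwo h (k • A) (k • B) = k ^ 2 * pairTwo h A B := by
  simp only [pairTwo, Pi.smul_apply, smul_eq_mul, Finset.mul_sum]
  refine Finset.sum_congr rfl fun a _ => Finset.sum_congr rfl fun b _ =>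
    Finset.sum_congr rfl fun a' _ => Finset.sum_congr rfl fun b' _ => by ring

lemma pairTwo_conformal (h : Matrix (Fin 4) (Fin 4) ℝ) (k : ℝ) (A B : Fin 4 → Fin 4 → ℝ) :
    pairTwo (k • h) A B = k ^ 2 * pairTwo h A B := by
  simp only [pairTwo, Matrix.smul_apply, smul_eq_mul, Finset.mul_sum]
  refine Finset.sum_congr rfl fun a _ => Finset.sum_congr rfl fun b _ =>
    Finset.sum_congr rfl fun a' _ => Finset.sum_congr rfl fun b' _ => by ring

lemma pairTwo_add_add (h : Matrix (Fin 4) (Fin 4) ℝ) (A B : Fin 4 → Fin 4 → ℝ) :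
    pairTwo h (A + B) (A + B)
      = pairTwo h A A + (pairTwo h A B + pairTwo h B A + pairTwo h B B) := by
  simp only [pairTwo, Pi.add_apply, ← Finset.sum_add_distrib]
  refine Finset.sum_congr rfl fun a _ => Finset.sum_congr rfl fun b _ =>
    Finset.sum_congr rfl fun a' _ => Finset.sum_congr rfl fun b' _ => by ring

lemma sqFour_smul (h : Matrix (Fin 4) (Fin 4) ℝ) (k : ℝ)
    (C : Fin 4 → Fin 4 → Fin 4 → Fin 4 → ℝ) :
    sqFour h (k • C) = k ^ 2 * sqFour h C := by
  simp only [sqFour, Pi.smul_apply, smul_eq_mul, Finset.mul_sum]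
  refine Finset.sum_congr rfl fun a _ => Finset.sum_congr rfl fun b _ =>
    Finset.sum_congr rfl fun c _ => Finset.sum_congr rfl fun d _ =>
    Finset.sum_congr rfl fun a' _ => Finset.sum_congr rfl fun b' _ =>
    Finset.sum_congr rfl fun c' _ => Finset.sum_congr rfl fun d' _ => by ring

lemma sqFour_conformal (h : Matrix (Fin 4) (Fin 4) ℝ) (k : ℝ)
    (C : Fin 4 → Fin 4 → Fin 4 → Fin 4 → ℝ) :
    sqFour (k • h) C = k ^ 4 * sqFour h C := by
  simp only [sqFour, Matrix.smul_apply, smul_eq_mul, Finset.mul_sum]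
  refine Finset.sum_congr rfl fun a _ => Finset.sum_congr rfl fun b _ =>
    Finset.sum_congr rfl fun c _ => Finset.sum_congr rfl fun d _ =>
    Finset.sum_congr rfl fun a' _ => Finset.sum_congr rfl fun b' _ =>
    Finset.sum_congr rfl fun c' _ => Finset.sum_congr rfl fun d' _ => by ring

/-! ### The leading part of the curvature of a conformally rescaled metric -/

/-- The difference tensor `δ^a_b T_c + δ^a_c T_b - g_{bc} T^a`, where `T^a = h^{ad} T_d`: the
Christoffel symbols of `e^{2u} g` exceed those of `g` by this array for `T = du`. -/
def diffTensor (g h : Matrix (Fin 4) (Fin 4) ℝ) (T : Fin 4 → ℝ) (a b c : Fin 4) : ℝ :=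
  (1 : Matrix (Fin 4) (Fin 4) ℝ) a b * T c + (1 : Matrix (Fin 4) (Fin 4) ℝ) a c * T b
    - g b c * h.mulVec T a

/-- The part of the Riemann tensor of `e^{2u} g`, `du = H T`, that is quadratic in `T`: the terms
with `p = H'` come from differentiating the factor `H` of the difference tensor `H E`, those with
`q = H²` from the products of two Christoffel symbols. -/
def leadingRiemann (g h : Matrix (Fin 4) (Fin 4) ℝ) (T : Fin 4 → ℝ) (p q : ℝ)
    (a b c d : Fin 4) : ℝ :=
  p * (T c * diffTensor g h T a d b - T d * diffTensor g h T a c b)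
    + q * ∑ e, (diffTensor g h T a c e * diffTensor g h T e d b
      - diffTensor g h T a d e * diffTensor g h T e c b)

section Leading

variable {g h : Matrix (Fin 4) (Fin 4) ℝ} (T : Fin 4 → ℝ)

lemma sum_diffTensor_mul (g h : Matrix (Fin 4) (Fin 4) ℝ) (a c : Fin 4) (f : Fin 4 → ℝ) :
    ∑ e, diffTensor g h T a c e * f e
      = (1 : Matrix (Fin 4) (Fin 4) ℝ) a c * ∑ e, T e * f e + T c * f a
        - h.mulVec T a * ∑ e, g c e * f e := by
  simp only [diffTensor, sub_mul, add_mul, Finset.sum_sub_distrib, Finset.sum_add_distrib,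
    Finset.mul_sum]
  congr 1
  · congr 1
    · exact Finset.sum_congr rfl fun e _ => by ring
    · simp [Matrix.one_apply]
  · exact Finset.sum_congr rfl fun e _ => by ring

lemma sum_mul_diffTensor (g h : Matrix (Fin 4) (Fin 4) ℝ) (d b : Fin 4) (f : Fin 4 → ℝ) :
    ∑ e, f e * diffTensor g h T e d b = f d * T b + f b * T d - g d b * (f ⬝ᵥ h.mulVec T) := by
  simp only [diffTensor, mul_sub, mul_add, Finset.sum_sub_distrib, Finset.sum_add_distrib,
    dotProduct, Finset.mul_sum]
  congr 1
  · simp [Matrix.one_apply]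
  · exact Finset.sum_congr rfl fun e _ => by ring

/-- With the first index lowered the right-hand side is a multiple of the Kulkarni–Nomizu product
of `g` and `T ⊗ T` plus a multiple of that of `g` and `g`, so its Weyl part vanishes. -/
lemma leadingRiemann_eq (hg : g.IsSymm) (hgh : g * h = 1) (p q : ℝ) (a b c d : Fin 4) :
    leadingRiemann g h T p q a b c d
      = (q - p) * ((1 : Matrix (Fin 4) (Fin 4) ℝ) a c * (T b * T d)
          - (1 : Matrix (Fin 4) (Fin 4) ℝ) a d * (T b * T c)
          + g b d * (h.mulVec T a * T c) - g b c * (h.mulVec T a * T d))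
        - q * (T ⬝ᵥ h.mulVec T) * ((1 : Matrix (Fin 4) (Fin 4) ℝ) a c * g b d
          - (1 : Matrix (Fin 4) (Fin 4) ℝ) a d * g b c) := by
  have hlow : ∀ c, (fun e => g c e) ⬝ᵥ h.mulVec T = T c := fun c => by
    have : g.mulVec (h.mulVec T) = T := by rw [Matrix.mulVec_mulVec, hgh, Matrix.one_mulVec]
    exact congrFun this c
  have hsymm : ∀ i j, g i j = g j i := fun i j => hg.apply j i
  rw [leadingRiemann, Finset.sum_sub_distrib, sum_diffTensor_mul, sum_diffTensor_mul,
    sum_mul_diffTensor T g h d b T, sum_mul_diffTensor T g h c b T,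
    sum_mul_diffTensor T g h d b (fun e => g c e), sum_mul_diffTensor T g h c b (fun e => g d e),
    hlow, hlow]
  simp only [diffTensor]
  rw [hsymm d b, hsymm c b, hsymm d c]
  ring

lemma ricciOf_leadingRiemann (hg : g.IsSymm) (hgh : g * h = 1) (p q : ℝ) (b d : Fin 4) :
    ricciOf (leadingRiemann g h T p q) b d
      = 2 * (q - p) * (T b * T d) - (p + 2 * q) * (T ⬝ᵥ h.mulVec T) * g b d := by
  have hlow : ∀ c, ∑ e, g c e * h.mulVec T e = T c := fun c => by
    have : g.mulVec (h.mulVec T) = T := by rw [Matrix.mulVec_mulVec, hgh, Matrix.one_mulVec]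
    exact congrFun this c
  simp only [ricciOf, leadingRiemann_eq T hg hgh]
  have h1 : ∑ c, g b d * (h.mulVec T c * T c) = g b d * (T ⬝ᵥ h.mulVec T) := by
    rw [dotProduct, Finset.mul_sum]
    exact Finset.sum_congr rfl fun e _ => by ring
  have h2 : ∑ c, g b c * (h.mulVec T c * T d) = T b * T d := by
    rw [← hlow b, Finset.sum_mul]
    exact Finset.sum_congr rfl fun e _ => by ring
  rw [Finset.sum_sub_distrib, ← Finset.mul_sum, ← Finset.mul_sum, Finset.sum_sub_distrib,
    Finset.sum_sub_distrib, Finset.sum_add_distrib, Finset.sum_sub_distrib, h1, h2]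
  simp [Matrix.one_apply]
  ring

lemma weylOf_leadingRiemann (hg : g.IsSymm) (hgh : g * h = 1) (p q : ℝ) :
    weylOf g h (leadingRiemann g h T p q) = 0 := by
  have hlow : ∀ c, ∑ e, g c e * h.mulVec T e = T c := fun c => by
    have : g.mulVec (h.mulVec T) = T := by rw [Matrix.mulVec_mulVec, hgh, Matrix.one_mulVec]
    exact congrFun this c
  have hsymm : ∀ i j, g i j = g j i := fun i j => hg.apply j i
  have htr : ∑ a, ∑ b, h a b * g a b = 4 := by
    have h1 : (g * h).trace = 4 := by rw [hgh]; simp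
    rw [Matrix.trace] at h1
    simp only [Matrix.diag_apply, Matrix.mul_apply] at h1
    rw [← h1, Finset.sum_comm]
    exact Finset.sum_congr rfl fun i _ => Finset.sum_congr rfl fun j _ => by
      rw [hsymm i j, mul_comm]
  have hTT : ∑ a, ∑ b, h a b * (T a * T b) = T ⬝ᵥ h.mulVec T := by
    simp only [dotProduct, Matrix.mulVec, Finset.mul_sum]
    exact Finset.sum_congr rfl fun i _ => Finset.sum_congr rfl fun j _ => by ring
  funext a b c d
  have hR : ∑ e, g a e * leadingRiemann g h T p q e b c d
      = (q - p) * (g a c * (T b * T d) - g a d * (T b * T c)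
          + g b d * (T a * T c) - g b c * (T a * T d))
        - q * (T ⬝ᵥ h.mulVec T) * (g a c * g b d - g a d * g b c) := by
    have h1 : ∀ c, ∑ e, g a e * (1 : Matrix (Fin 4) (Fin 4) ℝ) e c = g a c := fun c => by
      simp [Matrix.one_apply]
    rw [← hlow a, ← h1 c, ← h1 d]
    simp only [leadingRiemann_eq T hg hgh, Finset.sum_mul, Finset.mul_sum,
      ← Finset.sum_add_distrib, ← Finset.sum_sub_distrib]
    exact Finset.sum_congr rfl fun e _ => by ring
  have hS : ∑ a, ∑ b, h a b * ricciOf (leadingRiemann g h T p q) a b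
      = -6 * (p + q) * (T ⬝ᵥ h.mulVec T) := by
    have : ∑ a, ∑ b, h a b * ricciOf (leadingRiemann g h T p q) a b
      = 2 * (q - p) * (∑ a, ∑ b, h a b * (T a * T b))
        - (p + 2 * q) * (T ⬝ᵥ h.mulVec T) * ∑ a, ∑ b, h a b * g a b := by
      simp only [ricciOf_leadingRiemann T hg hgh, Finset.mul_sum, ← Finset.sum_sub_distrib]
      exact Finset.sum_congr rfl fun i _ => Finset.sum_congr rfl fun j _ => by ring
    rw [this, htr, hTT]
    ring
  rw [weylOf, hR, hS]
  simp only [ricciOf_leadingRiemann T hg hgh, Pi.zero_apply]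
  ring

lemma pairTwo_ricciOf_leadingRiemann (hg : g.IsSymm) (hgh : g * h = 1) (p q : ℝ) :
    pairTwo h (ricciOf (leadingRiemann g h T p q)) (ricciOf (leadingRiemann g h T p q))
      = 12 * (T ⬝ᵥ h.mulVec T) ^ 2 * (p ^ 2 + p * q + q ^ 2) := by
  have hsymm : ∀ i j, g i j = g j i := fun i j => hg.apply j i
  have hhsymm : ∀ i j, h i j = h j i := fun i j => by
    have : h = g⁻¹ := (Matrix.inv_eq_right_inv hgh).symm
    have h2 : h.IsSymm := by rw [this]; exact hg.inv
    exact h2.apply j i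
  have hhg : ∀ i j, ∑ k, h i k * g k j = (1 : Matrix (Fin 4) (Fin 4) ℝ) i j := fun i j => by
    rw [← Matrix.mul_apply, mul_eq_one_comm.mp hgh]
  have hV : ∀ i, ∑ k, h i k * T k = h.mulVec T i := fun i => rfl
  have hN : ∑ i, T i * h.mulVec T i = T ⬝ᵥ h.mulVec T := rfl
  -- raising both indices of `x T ⊗ T + y g` gives `x V ⊗ V + y h` with `V = h T`
  have hraise : ∀ (x y : ℝ) a b, ∑ a', ∑ b', h a a' * h b b' * (x * (T a' * T b') + y * g a' b')
      = x * (h.mulVec T a * h.mulVec T b) + y * h a b := fun x y a b => by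
    have e1 : ∀ a', ∑ b', h a a' * h b b' * (x * (T a' * T b') + y * g a' b')
        = x * h.mulVec T b * (h a a' * T a') + y * (h a a' * (1 : Matrix (Fin 4) (Fin 4) ℝ) b a') :=
      fun a' => by
        rw [← hhg b a', ← hV b, Finset.mul_sum, Finset.mul_sum, Finset.sum_mul, Finset.mul_sum,
          ← Finset.sum_add_distrib]
        exact Finset.sum_congr rfl fun j _ => by rw [hsymm a' j]; ring
    simp only [e1]
    rw [Finset.sum_add_distrib, ← Finset.mul_sum, ← Finset.mul_sum, hV]
    simp [Matrix.one_apply]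
    ring
  have key : ∀ x y : ℝ, pairTwo h (fun a b => x * (T a * T b) + y * g a b)
      (fun a b => x * (T a * T b) + y * g a b)
      = x ^ 2 * (T ⬝ᵥ h.mulVec T) ^ 2 + 2 * x * y * (T ⬝ᵥ h.mulVec T) + 4 * y ^ 2 := fun x y => by
    have e2 : pairTwo h (fun a b => x * (T a * T b) + y * g a b)
      (fun a b => x * (T a * T b) + y * g a b)
        = ∑ a, ∑ b, (x * (T a * T b) + y * g a b)
          * (x * (h.mulVec T a * h.mulVec T b) + y * h a b) := by
      rw [pairTwo]
      refine Finset.sum_congr rfl fun a _ => Finset.sum_congr rfl fun b _ => ?_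
      rw [← hraise, Finset.mul_sum]
      refine Finset.sum_congr rfl fun a' _ => ?_
      rw [Finset.mul_sum]
      exact Finset.sum_congr rfl fun b' _ => by ring
    have e3 : ∀ a, ∑ b, (x * (T a * T b) + y * g a b)
          * (x * (h.mulVec T a * h.mulVec T b) + y * h a b)
        = x ^ 2 * (T a * h.mulVec T a) * (T ⬝ᵥ h.mulVec T) + x * y * (T a * h.mulVec T a)
          + x * y * (h.mulVec T a * T a) + y ^ 2 := fun a => by
      have hlow : ∑ e, g a e * h.mulVec T e = T a := by
        have : g.mulVec (h.mulVec T) = T := by rw [Matrix.mulVec_mulVec, hgh, Matrix.one_mulVec]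
        exact congrFun this a
      have h1 : ∑ b, g a b * h b a = 1 := by
        rw [← Matrix.mul_apply, hgh, Matrix.one_apply_eq]
      calc _ = ∑ b, (x ^ 2 * (T a * h.mulVec T a) * (T b * h.mulVec T b)
              + x * y * T a * (h a b * T b) + x * y * h.mulVec T a * (g a b * h.mulVec T b)
              + y ^ 2 * (g a b * h b a)) :=
            Finset.sum_congr rfl fun b _ => by rw [hhsymm b a]; ring
        _ = _ := by
          rw [Finset.sum_add_distrib, Finset.sum_add_distrib, Finset.sum_add_distrib,
            ← Finset.mul_sum, ← Finset.mul_sum, ← Finset.mul_sum, ← Finset.mul_sum, hV, hlow, h1,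
            hN]
          ring
    rw [e2]
    simp only [e3]
    calc _ = ∑ a, ((x ^ 2 * (T ⬝ᵥ h.mulVec T) + 2 * x * y) * (T a * h.mulVec T a) + y ^ 2) :=
          Finset.sum_congr rfl fun a _ => by ring
      _ = _ := by
        rw [Finset.sum_add_distrib, ← Finset.mul_sum, hN]
        simp
        ring
  have hR : ricciOf (leadingRiemann g h T p q) = fun a b => (2 * (q - p)) * (T a * T b)
      + (-((p + 2 * q) * (T ⬝ᵥ h.mulVec T))) * g a b := by
    funext a b
    rw [ricciOf_leadingRiemann T hg hgh]
    ring
  rw [hR, key]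
  ring

end Leading

/-! ### Partial derivatives in coordinates -/

section PartialDerivatives

variable {f k : Coord → ℝ} {x : Coord} {V : Set Coord}

lemma pd_congr {i : Fin 4} (h : f =ᶠ[𝓝 x] k) : pd i f x = pd i k x := by
  rw [pd, pd, h.fderiv_eq]

lemma pd_add {i : Fin 4} (hf : DifferentiableAt ℝ f x) (hk : DifferentiableAt ℝ k x) :
    pd i (fun y => f y + k y) x = pd i f x + pd i k x := by
  simp [pd, fderiv_fun_add hf hk]

lemma pd_mul {i : Fin 4} (hf : DifferentiableAt ℝ f x) (hk : DifferentiableAt ℝ k x) :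
    pd i (fun y => f y * k y) x = f x * pd i k x + pd i f x * k x := by
  simp [pd, fderiv_fun_mul hf hk, mul_comm]

lemma pd_comp {i : Fin 4} {Φ : ℝ → ℝ} (hΦ : DifferentiableAt ℝ Φ (f x))
    (hf : DifferentiableAt ℝ f x) :
    pd i (fun y => Φ (f y)) x = deriv Φ (f x) * pd i f x := by
  have := (hΦ.hasDerivAt.comp_hasFDerivAt x hf.hasFDerivAt).fderiv
  simp only [Function.comp_def] at this
  simp [pd, this]

lemma contDiffOn_pd {m n : WithTop ℕ∞} (hV : IsOpen V) (hf : ContDiffOn ℝ n f V)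
    (hmn : m + 1 ≤ n) (i : Fin 4) : ContDiffOn ℝ m (pd i f) V :=
  (hf.fderiv_of_isOpen hV hmn).clm_apply contDiffOn_const

end PartialDerivatives

lemma contDiffOn_det {n : WithTop ℕ∞} {V : Set Coord} {A : Coord → Matrix (Fin 4) (Fin 4) ℝ}
    (hA : ∀ i j, ContDiffOn ℝ n (fun x => A x i j) V) :
    ContDiffOn ℝ n (fun x => (A x).det) V := by
  simp only [Matrix.det_apply']
  exact ContDiffOn.sum fun σ _ => contDiffOn_const.mul (contDiffOn_prod fun i _ => hA _ _)

lemma contDiffOn_inv {n : WithTop ℕ∞} {V : Set Coord} {A : Coord → Matrix (Fin 4) (Fin 4) ℝ}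
    (hA : ∀ i j, ContDiffOn ℝ n (fun x => A x i j) V) (hdet : ∀ x ∈ V, (A x).det ≠ 0)
    (i j : Fin 4) : ContDiffOn ℝ n (fun x => (A x)⁻¹ i j) V := by
  simp only [Matrix.inv_def, Ring.inverse_eq_inv', Matrix.smul_apply, smul_eq_mul,
    Matrix.adjugate_apply]
  refine ((contDiffOn_det hA).inv hdet).mul (contDiffOn_det fun a b => ?_)
  simp only [Matrix.updateRow_apply]
  split_ifs
  · exact contDiffOn_const
  · exact hA a b

/-! ### The curvature of a conformally rescaled metric -/

lemma diffTensor_smul (g h : Matrix (Fin 4) (Fin 4) ℝ) (k : ℝ) (T : Fin 4 → ℝ) (a b c : Fin 4) :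
    diffTensor g h (k • T) a b c = k * diffTensor g h T a b c := by
  simp only [diffTensor, Matrix.mulVec_smul, Pi.smul_apply, smul_eq_mul]
  ring

lemma inv_smul_metric {F : ℝ} (hF : F ≠ 0) {g : Matrix (Fin 4) (Fin 4) ℝ} (hg : g.det ≠ 0) :
    (F • g)⁻¹ = F⁻¹ • g⁻¹ := by
  refine Matrix.inv_eq_right_inv ?_
  rw [Matrix.smul_mul, Matrix.mul_smul, smul_smul, mul_inv_cancel₀ hF, one_smul,
    Matrix.mul_nonsing_inv _ (isUnit_iff_ne_zero.mpr hg)]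

lemma christoffel_conformal {G : Coord → Matrix (Fin 4) (Fin 4) ℝ} {f : Coord → ℝ} {y : Coord}
    (hG : ∀ i j, DifferentiableAt ℝ (fun x => G x i j) y) (hdet : (G y).det ≠ 0)
    (hf : DifferentiableAt ℝ f y) (hfy : f y ≠ 0) (a b c : Fin 4) :
    christoffel (fun x => f x ^ 2 • G x) a b c y
      = christoffel G a b c y
        + diffTensor (G y) (G y)⁻¹ ((f y)⁻¹ • fun i => pd i f y) a b c := by
  have hpd : ∀ i j k, pd k (fun x => f x ^ 2 * G x i j) y
      = f y ^ 2 * pd k (fun x => G x i j) y + 2 * f y * pd k f y * G y i j := fun i j k => by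
    have h1 : pd k (fun x => f x ^ 2) y = 2 * f y * pd k f y := by
      simp only [sq]
      rw [pd_mul hf hf]
      ring
    rw [pd_mul (f := fun x => f x ^ 2) (hf.pow 2) (hG i j), h1]
  have hinv : invMetric (fun x => f x ^ 2 • G x) y = (f y ^ 2)⁻¹ • (G y)⁻¹ :=
    inv_smul_metric (pow_ne_zero 2 hfy) hdet
  have hone : ∀ c, ∑ d, (G y)⁻¹ a d * G y d c = (1 : Matrix (Fin 4) (Fin 4) ℝ) a c := fun c => by
    rw [← Matrix.mul_apply, Matrix.nonsing_inv_mul _ (isUnit_iff_ne_zero.mpr hdet)]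
  have hmv : (G y)⁻¹.mulVec ((f y)⁻¹ • fun i => pd i f y) a
      = (f y)⁻¹ * ∑ d, (G y)⁻¹ a d * pd d f y := by
    rw [Matrix.mulVec_smul]; rfl
  rw [christoffel, christoffel, diffTensor, hmv, ← hone b, ← hone c]
  simp only [hinv]
  simp only [Matrix.smul_apply, Pi.smul_apply, smul_eq_mul, Finset.mul_sum,
    Finset.sum_mul, ← Finset.sum_add_distrib, ← Finset.sum_sub_distrib, invMetric, hpd]
  refine Finset.sum_congr rfl fun d _ => ?_
  field_simp
  ring

/-- The difference tensor of the conformal factor `e^{2τ}`, as a field of arrays. -/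
def diffField (G : Coord → Matrix (Fin 4) (Fin 4) ℝ) (τ : Coord → ℝ) (a b c : Fin 4)
    (x : Coord) : ℝ :=
  diffTensor (G x) (G x)⁻¹ (fun i => pd i τ x) a b c

/-- The part of the Riemann tensor that is linear in the difference tensor `diffField G τ`: twice
its antisymmetrized covariant derivative. -/
def linearRiemann (G : Coord → Matrix (Fin 4) (Fin 4) ℝ) (τ : Coord → ℝ) (a b c d : Fin 4)
    (x : Coord) : ℝ :=
  pd c (diffField G τ a d b) x - pd d (diffField G τ a c b) x
    + ∑ e, (christoffel G a c e x * diffField G τ e d b x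
      + diffField G τ a c e x * christoffel G e d b x
      - christoffel G a d e x * diffField G τ e c b x
      - diffField G τ a d e x * christoffel G e c b x)

section Regularity

variable {G : Coord → Matrix (Fin 4) (Fin 4) ℝ} {τ : Coord → ℝ} {V : Set Coord}

lemma contDiffOn_christoffel (hV : IsOpen V) (hG : ∀ i j, ContDiffOn ℝ 2 (fun x => G x i j) V)
    (hdet : ∀ x ∈ V, (G x).det ≠ 0) (a b c : Fin 4) :
    ContDiffOn ℝ 1 (christoffel G a b c) V := by
  have h12 : (1 : WithTop ℕ∞) + 1 ≤ 2 := by norm_num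
  refine contDiffOn_const.mul (ContDiffOn.sum fun d _ => ContDiffOn.mul ?_ ?_)
  · exact (contDiffOn_inv hG hdet a d).of_le (by norm_num)
  · exact ((contDiffOn_pd hV (hG _ _) h12 _).add (contDiffOn_pd hV (hG _ _) h12 _)).sub
      (contDiffOn_pd hV (hG _ _) h12 _)

lemma contDiffOn_diffField (hV : IsOpen V) (hG : ∀ i j, ContDiffOn ℝ 2 (fun x => G x i j) V)
    (hdet : ∀ x ∈ V, (G x).det ≠ 0) (hτ : ContDiffOn ℝ 2 τ V) (a b c : Fin 4) :
    ContDiffOn ℝ 1 (diffField G τ a b c) V := by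
  have h12 : (1 : WithTop ℕ∞) + 1 ≤ 2 := by norm_num
  have hτ1 : ∀ i, ContDiffOn ℝ 1 (pd i τ) V := fun i => contDiffOn_pd hV hτ h12 i
  have hmv : ContDiffOn ℝ 1 (fun x => (G x)⁻¹.mulVec (fun i => pd i τ x) a) V := by
    simp only [Matrix.mulVec, dotProduct]
    exact ContDiffOn.sum fun d _ =>
      ((contDiffOn_inv hG hdet a d).of_le (by norm_num)).mul (hτ1 d)
  exact ((contDiffOn_const.mul (hτ1 c)).add (contDiffOn_const.mul (hτ1 b))).sub
    (((hG b c).of_le (by norm_num)).mul hmv)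

lemma continuousOn_pd (hV : IsOpen V) {f : Coord → ℝ} (hf : ContDiffOn ℝ 1 f V) (i : Fin 4) :
    ContinuousOn (pd i f) V :=
  (contDiffOn_pd (m := 0) hV hf (by norm_num) i).continuousOn

lemma continuousOn_riemannUp (hV : IsOpen V) (hG : ∀ i j, ContDiffOn ℝ 2 (fun x => G x i j) V)
    (hdet : ∀ x ∈ V, (G x).det ≠ 0) (a b c d : Fin 4) :
    ContinuousOn (riemannUp G a b c d) V := by
  have hΓ := contDiffOn_christoffel hV hG hdet
  have hΓ0 : ∀ a b c, ContinuousOn (christoffel G a b c) V := fun a b c => (hΓ a b c).continuousOn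
  exact ((continuousOn_pd hV (hΓ _ _ _) _).sub (continuousOn_pd hV (hΓ _ _ _) _)).add
    (continuousOn_finsetSum _ fun e _ =>
      ((hΓ0 _ _ _).mul (hΓ0 _ _ _)).sub ((hΓ0 _ _ _).mul (hΓ0 _ _ _)))

lemma continuousOn_linearRiemann (hV : IsOpen V)
    (hG : ∀ i j, ContDiffOn ℝ 2 (fun x => G x i j) V)
    (hdet : ∀ x ∈ V, (G x).det ≠ 0) (hτ : ContDiffOn ℝ 2 τ V) (a b c d : Fin 4) :
    ContinuousOn (linearRiemann G τ a b c d) V := by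
  have hE := contDiffOn_diffField hV hG hdet hτ
  have hΓ0 : ∀ a b c, ContinuousOn (christoffel G a b c) V := fun a b c =>
    (contDiffOn_christoffel hV hG hdet a b c).continuousOn
  have hE0 : ∀ a b c, ContinuousOn (diffField G τ a b c) V := fun a b c => (hE a b c).continuousOn
  exact ((continuousOn_pd hV (hE _ _ _) _).sub (continuousOn_pd hV (hE _ _ _) _)).add
    (continuousOn_finsetSum _ fun e _ =>
      ((((hΓ0 _ _ _).mul (hE0 _ _ _)).add ((hE0 _ _ _).mul (hΓ0 _ _ _))).sub
        ((hΓ0 _ _ _).mul (hE0 _ _ _))).sub ((hE0 _ _ _).mul (hΓ0 _ _ _)))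

end Regularity

/-- The Riemann tensor of `Ω(τ)² G`, sorted by powers of the logarithmic derivative `H` of `Ω`.
Only undifferentiated terms in `dτ ⊗ dτ` come with a factor `H'` or `H²`. -/
lemma riemannUp_conformal {G : Coord → Matrix (Fin 4) (Fin 4) ℝ} {τ : Coord → ℝ} {V : Set Coord}
    (hV : IsOpen V) (hG : ∀ i j, ContDiffOn ℝ 2 (fun x => G x i j) V)
    (hdet : ∀ x ∈ V, (G x).det ≠ 0) (hτ : ContDiffOn ℝ 2 τ V) {Ω : ℝ → ℝ} {J : Set ℝ}
    (hJ : IsOpen J) (hΩ : ContDiffOn ℝ 2 Ω J) (hΩ0 : ∀ t ∈ J, Ω t ≠ 0) {x : Coord} (hx : x ∈ V)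
    (hxJ : τ x ∈ J) (a b c d : Fin 4) :
    riemannUp (fun y => Ω (τ y) ^ 2 • G y) a b c d x
      = riemannUp G a b c d x + logDeriv Ω (τ x) * linearRiemann G τ a b c d x
        + leadingRiemann (G x) (G x)⁻¹ (fun i => pd i τ x) (deriv (logDeriv Ω) (τ x))
            (logDeriv Ω (τ x) ^ 2) a b c d := by
  have hτd : ∀ y ∈ V, DifferentiableAt ℝ τ y := fun y hy =>
    (hτ.contDiffAt (hV.mem_nhds hy)).differentiableAt (by norm_num)
  have hΓ : ∀ a b c, ∀ y ∈ V, τ y ∈ J → christoffel (fun y => Ω (τ y) ^ 2 • G y) a b c y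
      = christoffel G a b c y + logDeriv Ω (τ y) * diffField G τ a b c y := by
    intro a b c y hy hyJ
    have hΩd : DifferentiableAt ℝ Ω (τ y) :=
      (hΩ.contDiffAt (hJ.mem_nhds hyJ)).differentiableAt (by norm_num)
    rw [christoffel_conformal (f := fun y => Ω (τ y))
      (fun i j => ((hG i j).contDiffAt (hV.mem_nhds hy)).differentiableAt (by norm_num))
      (hdet y hy) (hΩd.comp y (hτd y hy)) (hΩ0 _ hyJ), diffField, ← diffTensor_smul]
    congr 2
    funext i
    simp only [Pi.smul_apply, smul_eq_mul, pd_comp hΩd (hτd y hy), logDeriv_apply]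
    ring
  have hnear : ∀ᶠ y in 𝓝 x, y ∈ V ∧ τ y ∈ J :=
    (hV.eventually_mem hx).and ((hτd x hx).continuousAt.eventually_mem (hJ.mem_nhds hxJ))
  have hH : DifferentiableAt ℝ (logDeriv Ω) (τ x) := by
    have h1 : ContDiffOn ℝ 1 (deriv Ω) J := hΩ.deriv_of_isOpen hJ (by norm_num)
    exact ((h1.contDiffAt (hJ.mem_nhds hxJ)).differentiableAt (by norm_num)).div
      ((hΩ.contDiffAt (hJ.mem_nhds hxJ)).differentiableAt (by norm_num)) (hΩ0 _ hxJ)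
  have hpd : ∀ a b c i, pd i (christoffel (fun y => Ω (τ y) ^ 2 • G y) a b c) x
      = pd i (christoffel G a b c) x + (logDeriv Ω (τ x) * pd i (diffField G τ a b c) x
        + deriv (logDeriv Ω) (τ x) * pd i τ x * diffField G τ a b c x) := by
    intro a b c i
    have hΓd : DifferentiableAt ℝ (christoffel G a b c) x :=
      ((contDiffOn_christoffel hV hG hdet a b c).contDiffAt (hV.mem_nhds hx)).differentiableAt
        (by norm_num)
    have hEd : DifferentiableAt ℝ (diffField G τ a b c) x :=
      ((contDiffOn_diffField hV hG hdet hτ a b c).contDiffAt (hV.mem_nhds hx)).differentiableAt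
        (by norm_num)
    have hHd : DifferentiableAt ℝ (fun y => logDeriv Ω (τ y)) x := hH.comp x (hτd x hx)
    rw [pd_congr (hnear.mono fun y hy => hΓ a b c y hy.1 hy.2), 
      pd_add (k := fun y => logDeriv Ω (τ y) * diffField G τ a b c y) hΓd (hHd.mul hEd),
      pd_mul hHd hEd, pd_comp hH (hτd x hx)]
  simp only [riemannUp, linearRiemann, leadingRiemann, hpd, hΓ _ _ _ x hx hxJ]
  change _ + ∑ e, _ = _ + ∑ e, _ + _ * (_ + ∑ e, _) + (_ + _ * ∑ e, _)
  have hsum : ∀ e, (christoffel G a c e x + logDeriv Ω (τ x) * diffField G τ a c e x)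
        * (christoffel G e d b x + logDeriv Ω (τ x) * diffField G τ e d b x)
      - (christoffel G a d e x + logDeriv Ω (τ x) * diffField G τ a d e x)
        * (christoffel G e c b x + logDeriv Ω (τ x) * diffField G τ e c b x)
      = (christoffel G a c e x * christoffel G e d b x
          - christoffel G a d e x * christoffel G e c b x)
        + logDeriv Ω (τ x) * (christoffel G a c e x * diffField G τ e d b x
          + diffField G τ a c e x * christoffel G e d b x
          - christoffel G a d e x * diffField G τ e c b x
          - diffField G τ a d e x * christoffel G e c b x)
        + logDeriv Ω (τ x) ^ 2 * (diffField G τ a c e x * diffField G τ e d b x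
          - diffField G τ a d e x * diffField G τ e c b x) := fun e => by ring
  simp only [hsum, Finset.sum_add_distrib, ← Finset.mul_sum]
  simp only [diffField]
  ring

/-! ### The limit of the scalar `K` in coordinates -/

lemma leadingRiemann_linear (g h : Matrix (Fin 4) (Fin 4) ℝ) (T : Fin 4 → ℝ) (p q : ℝ) :
    leadingRiemann g h T p q = p • leadingRiemann g h T 1 0 + q • leadingRiemann g h T 0 1 := by
  funext a b c d
  simp [leadingRiemann]

lemma continuous_weylOf (a b c d : Fin 4) :
    Continuous fun z : Matrix (Fin 4) (Fin 4) ℝ × Matrix (Fin 4) (Fin 4) ℝ ×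
      (Fin 4 → Fin 4 → Fin 4 → Fin 4 → ℝ) => weylOf z.1 z.2.1 z.2.2 a b c d := by
  unfold weylOf ricciOf
  fun_prop

lemma continuous_sqFour :
    Continuous fun z : Matrix (Fin 4) (Fin 4) ℝ × (Fin 4 → Fin 4 → Fin 4 → Fin 4 → ℝ) =>
      sqFour z.1 z.2 := by
  unfold sqFour
  fun_prop

lemma continuous_pairTwo :
    Continuous fun z : Matrix (Fin 4) (Fin 4) ℝ × (Fin 4 → Fin 4 → ℝ) × (Fin 4 → Fin 4 → ℝ) =>
      pairTwo z.1 z.2.1 z.2.2 := by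
  unfold pairTwo
  fun_prop

lemma continuous_ricciOf : Continuous ricciOf := by
  unfold ricciOf
  fun_prop

lemma continuous_leadingRiemann (p q : ℝ) :
    Continuous fun z : Matrix (Fin 4) (Fin 4) ℝ × Matrix (Fin 4) (Fin 4) ℝ × (Fin 4 → ℝ) =>
      leadingRiemann z.1 z.2.1 z.2.2 p q := by
  unfold leadingRiemann diffTensor Matrix.mulVec dotProduct
  fun_prop

lemma pairTwo_add_left (h : Matrix (Fin 4) (Fin 4) ℝ) (A A' B : Fin 4 → Fin 4 → ℝ) :
    pairTwo h (A + A') B = pairTwo h A B + pairTwo h A' B := by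
  simp only [pairTwo, Pi.add_apply, ← Finset.sum_add_distrib]
  refine Finset.sum_congr rfl fun a _ => Finset.sum_congr rfl fun b _ =>
    Finset.sum_congr rfl fun a' _ => Finset.sum_congr rfl fun b' _ => by ring

lemma pairTwo_smul_left (h : Matrix (Fin 4) (Fin 4) ℝ) (k : ℝ) (A B : Fin 4 → Fin 4 → ℝ) :
    pairTwo h (k • A) B = k * pairTwo h A B := by
  simp only [pairTwo, Pi.smul_apply, smul_eq_mul, Finset.mul_sum]
  refine Finset.sum_congr rfl fun a _ => Finset.sum_congr rfl fun b _ =>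
    Finset.sum_congr rfl fun a' _ => Finset.sum_congr rfl fun b' _ => by ring

lemma pairTwo_zero_right (h : Matrix (Fin 4) (Fin 4) ℝ) (A : Fin 4 → Fin 4 → ℝ) :
    pairTwo h A 0 = 0 := by
  simp [pairTwo]

lemma pairTwo_comm (h : Matrix (Fin 4) (Fin 4) ℝ) (hh : h.IsSymm) (A B : Fin 4 → Fin 4 → ℝ) :
    pairTwo h A B = pairTwo h B A := by
  have e : ∀ A B : Fin 4 → Fin 4 → ℝ, pairTwo h A B
      = ∑ z : (Fin 4 × Fin 4) × (Fin 4 × Fin 4),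
        h z.1.1 z.2.1 * h z.1.2 z.2.2 * A z.1.1 z.1.2 * B z.2.1 z.2.2 := fun A B => by
    simp only [pairTwo, Fintype.sum_prod_type]
  rw [e, e]
  refine Fintype.sum_equiv (Equiv.prodComm _ _) _ _ fun z => ?_
  rw [Equiv.prodComm_apply, Prod.fst_swap, Prod.snd_swap, hh.apply z.1.1 z.2.1,
    hh.apply z.1.2 z.2.2]
  ring

lemma quarter_le_sq_add_mul_add_sq {p q : ℝ} (h : |p| + |q| = 1) :
    1 / 4 ≤ p ^ 2 + p * q + q ^ 2 := by
  have h1 : -(|p| * |q|) ≤ p * q := by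
    rw [← abs_mul]; exact neg_abs_le _
  have h2 := sq_abs p
  have h3 := sq_abs q
  have h4 : (|p| + |q|) ^ 2 = 1 := by rw [h, one_pow]
  nlinarith [sq_nonneg (|p| - |q|)]

lemma tendsto_div_of_common_factor {X : Type*} {l : Filter X} {w r c A B : X → ℝ} {m : ℝ}
    (hrw : ∀ᶠ x in l, r x = c x * A x ∧ w x = c x * B x) (hc : ∀ᶠ x in l, c x ≠ 0)
    (hm : 0 < m) (hA : ∀ᶠ x in l, m ≤ A x) (hB : Tendsto B l (𝓝 0)) :
    (∀ᶠ x in l, r x ≠ 0) ∧ Tendsto (fun x => w x / r x) l (𝓝 0) := by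
  constructor
  · filter_upwards [hrw, hA, hc] with x hx hxm hxc
    rw [hx.1]
    exact mul_ne_zero hxc (hm.trans_le hxm).ne'
  · have hbound : Tendsto (fun x => |B x| / m) l (𝓝 0) := by simpa using hB.abs.div_const m
    refine squeeze_zero_norm' ?_ hbound
    filter_upwards [hrw, hA, hc] with x hx hxm hxc
    rw [hx.1, hx.2, mul_div_mul_left _ _ hxc, norm_div, Real.norm_eq_abs, Real.norm_eq_abs,
      abs_of_pos (hm.trans_le hxm)]
    gcongr

/-- The pointwise limit: an array `P + ρ`, with `P` of the form that the conformal factor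
contributes, normalized by `|p| + |q| = 1`, and `ρ → 0`, has Weyl part tending to zero, while the
square of its Ricci part stays away from zero. -/
lemma normalized_curvature_limits {X : Type*} {l : Filter X}
    {g : X → Matrix (Fin 4) (Fin 4) ℝ} {T : X → Fin 4 → ℝ} {p q : X → ℝ}
    {ρ : X → Fin 4 → Fin 4 → Fin 4 → Fin 4 → ℝ} {g₀ h₀ : Matrix (Fin 4) (Fin 4) ℝ} {T₀ : Fin 4 → ℝ}
    (hg : Tendsto g l (𝓝 g₀)) (hh : Tendsto (fun x => (g x)⁻¹) l (𝓝 h₀))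
    (hT : Tendsto T l (𝓝 T₀)) (hρ : Tendsto ρ l (𝓝 0))
    (hsymm : ∀ᶠ x in l, (g x).IsSymm) (hdet : ∀ᶠ x in l, (g x).det ≠ 0)
    (hpq : ∀ᶠ x in l, |p x| + |q x| = 1) (hN : T₀ ⬝ᵥ h₀.mulVec T₀ ≠ 0) :
    Tendsto (fun x => sqFour (g x)⁻¹
      (weylOf (g x) (g x)⁻¹ (leadingRiemann (g x) (g x)⁻¹ (T x) (p x) (q x) + ρ x))) l (𝓝 0) ∧
    ∃ m > 0, ∀ᶠ x in l, m ≤ pairTwo (g x)⁻¹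
      (ricciOf (leadingRiemann (g x) (g x)⁻¹ (T x) (p x) (q x) + ρ x))
      (ricciOf (leadingRiemann (g x) (g x)⁻¹ (T x) (p x) (q x) + ρ x)) := by
  have hgi : ∀ᶠ x in l, g x * (g x)⁻¹ = 1 := hdet.mono fun x hx =>
    Matrix.mul_nonsing_inv _ (isUnit_iff_ne_zero.mpr hx)
  constructor
  · have hW : Tendsto (fun x => weylOf (g x) (g x)⁻¹ (ρ x)) l (𝓝 0) := by
      simp only [tendsto_pi_nhds]
      intro a b c d
      have := ((continuous_weylOf a b c d).tendsto (g₀, h₀, 0)).comp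
        (hg.prodMk_nhds (hh.prodMk_nhds hρ))
      have h0 : weylOf g₀ h₀ 0 a b c d = 0 := by simp [weylOf, ricciOf]
      rw [h0] at this
      exact this
    have h0 : Tendsto (fun x => sqFour (g x)⁻¹ (weylOf (g x) (g x)⁻¹ (ρ x))) l (𝓝 0) := by
      have := (continuous_sqFour.tendsto (h₀, 0)).comp (hh.prodMk_nhds hW)
      have h0 : sqFour h₀ 0 = 0 := by simpa using sqFour_smul h₀ 0 0
      exact h0 ▸ this
    refine h0.congr' ?_
    filter_upwards [hsymm, hgi] with x hx hxi
    rw [weylOf_add, weylOf_leadingRiemann _ hx hxi, zero_add]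
  · have hB : Tendsto (fun x => ricciOf (ρ x)) l (𝓝 0) := by
      have := (continuous_ricciOf.tendsto 0).comp hρ
      have h0 : ricciOf 0 = 0 := by funext b d; simp [ricciOf]
      rwa [h0] at this
    have hcross : ∀ r s : ℝ, Tendsto (fun x => pairTwo (g x)⁻¹
        (ricciOf (leadingRiemann (g x) (g x)⁻¹ (T x) r s)) (ricciOf (ρ x))) l (𝓝 0) := by
      intro r s
      have hA := (continuous_ricciOf.tendsto _).comp
        (((continuous_leadingRiemann r s).tendsto (g₀, h₀, T₀)).comp
          (hg.prodMk_nhds (hh.prodMk_nhds hT)))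
      have := (continuous_pairTwo.tendsto (h₀, _, 0)).comp (hh.prodMk_nhds (hA.prodMk_nhds hB))
      exact pairTwo_zero_right h₀ _ ▸ this
    have hBB : Tendsto (fun x => pairTwo (g x)⁻¹ (ricciOf (ρ x)) (ricciOf (ρ x))) l (𝓝 0) := by
      have := (continuous_pairTwo.tendsto (h₀, 0, 0)).comp (hh.prodMk_nhds (hB.prodMk_nhds hB))
      exact pairTwo_zero_right h₀ _ ▸ this
    have hNlim : Tendsto (fun x => T x ⬝ᵥ (g x)⁻¹.mulVec (T x)) l
        (𝓝 (T₀ ⬝ᵥ h₀.mulVec T₀)) := by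
      have hc : Continuous fun z : Matrix (Fin 4) (Fin 4) ℝ × (Fin 4 → ℝ) =>
          z.2 ⬝ᵥ z.1.mulVec z.2 := by
        unfold Matrix.mulVec dotProduct
        fun_prop
      exact (hc.tendsto (h₀, T₀)).comp (hh.prodMk_nhds hT)
    set N := T₀ ⬝ᵥ h₀.mulVec T₀ with hNdef
    have hNpos : 0 < N ^ 2 := by positivity
    refine ⟨N ^ 2 / 2, by positivity, ?_⟩
    have e1 := (hNlim.pow 2).eventually (lt_mem_nhds (show N ^ 2 / 2 < N ^ 2 by linarith))
    have small : ∀ {f : X → ℝ}, Tendsto f l (𝓝 0) → ∀ᶠ x in l, |f x| < N ^ 2 / 8 := fun hf => by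
      simpa using hf.abs.eventually (gt_mem_nhds (show |(0 : ℝ)| < N ^ 2 / 8 by simpa using hNpos))
    filter_upwards [hsymm, hgi, hpq, e1, small (hcross 1 0), small (hcross 0 1), small hBB]
      with x hx hxi hx1 hxN h10 h01 h00
    have hadd : ∀ R R' : Fin 4 → Fin 4 → Fin 4 → Fin 4 → ℝ,
        ricciOf (R + R') = ricciOf R + ricciOf R' := fun R R' => by
      funext b d; exact ricciOf_add R R' b d
    have hsmul : ∀ (k : ℝ) (R : Fin 4 → Fin 4 → Fin 4 → Fin 4 → ℝ),
        ricciOf (k • R) = k • ricciOf R := fun k R => by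
      funext b d; exact ricciOf_smul k R b d
    have hexp := pairTwo_ricciOf_leadingRiemann (T x) hx hxi (p x) (q x)
    have hlin : pairTwo (g x)⁻¹ (ricciOf (leadingRiemann (g x) (g x)⁻¹ (T x) (p x) (q x)))
        (ricciOf (ρ x)) = p x * pairTwo (g x)⁻¹
          (ricciOf (leadingRiemann (g x) (g x)⁻¹ (T x) 1 0)) (ricciOf (ρ x))
        + q x * pairTwo (g x)⁻¹
          (ricciOf (leadingRiemann (g x) (g x)⁻¹ (T x) 0 1)) (ricciOf (ρ x)) := by
      rw [leadingRiemann_linear, hadd, hsmul, hsmul, pairTwo_add_left, pairTwo_smul_left,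
        pairTwo_smul_left]
    rw [hadd, pairTwo_add_add, hexp, pairTwo_comm _ hx.inv (ricciOf (ρ x)), hlin]
    clear hlin hexp
    generalize pairTwo (g x)⁻¹
      (ricciOf (leadingRiemann (g x) (g x)⁻¹ (T x) 1 0)) (ricciOf (ρ x)) = c1 at h10 ⊢
    generalize pairTwo (g x)⁻¹
      (ricciOf (leadingRiemann (g x) (g x)⁻¹ (T x) 0 1)) (ricciOf (ρ x)) = c2 at h01 ⊢
    generalize pairTwo (g x)⁻¹ (ricciOf (ρ x)) (ricciOf (ρ x)) = c3 at h00 ⊢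
    generalize T x ⬝ᵥ (g x)⁻¹.mulVec (T x) = n at hxN ⊢
    have hp : |p x * c1| ≤ |p x| * (N ^ 2 / 8) := by
      rw [abs_mul]; exact mul_le_mul_of_nonneg_left h10.le (abs_nonneg _)
    have hq : |q x * c2| ≤ |q x| * (N ^ 2 / 8) := by
      rw [abs_mul]; exact mul_le_mul_of_nonneg_left h01.le (abs_nonneg _)
    have hsum : |p x| * (N ^ 2 / 8) + |q x| * (N ^ 2 / 8) = N ^ 2 / 8 := by
      rw [← add_mul, hx1, one_mul]
    have hquad := quarter_le_sq_add_mul_add_sq hx1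
    have hmain : 12 * (N ^ 2 / 2) * (1 / 4)
        ≤ 12 * n ^ 2 * (p x ^ 2 + p x * q x + q x ^ 2) := by
      gcongr
    have := (abs_le.mp hp).1
    have := (abs_le.mp hq).1
    have := (abs_lt.mp h00).1
    linarith

/-- How the two scalars scale under a conformal change `F • g` of the metric at a point and a
rescaling of the Riemann tensor there: both carry the same factor. -/
lemma curvature_squares_of_smul {G : Coord → Matrix (Fin 4) (Fin 4) ℝ} {x : Coord}
    {g : Matrix (Fin 4) (Fin 4) ℝ} {F k : ℝ} {R : Fin 4 → Fin 4 → Fin 4 → Fin 4 → ℝ}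
    (hGx : G x = F • g) (hF : F ≠ 0) (hg : g.det ≠ 0)
    (hR : (fun a b c d => riemannUp G a b c d x) = k • R) :
    ricciSq G x = (F⁻¹ * k) ^ 2 * pairTwo g⁻¹ (ricciOf R) (ricciOf R) ∧
      weylSq G x = (F⁻¹ * k) ^ 2 * sqFour g⁻¹ (weylOf g g⁻¹ R) := by
  have hsm : ricciOf (k • R) = k • ricciOf R := by
    funext b d; exact ricciOf_smul _ _ b d
  rw [ricciSq_eq_pairTwo, weylSq_eq_sqFour, hR, hGx, inv_smul_metric hF hg,
    pairTwo_conformal, hsm, pairTwo_smul, sqFour_conformal, weylOf_conformal hF, sqFour_smul,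
    weylOf_smul, sqFour_smul]
  constructor
  · ring
  · field_simp

/-- The limit of `K` for the metric `Ω(τ)² G` in coordinates, along any filter at `x₀` along which
`|H| → ∞`. The Riemann tensor is divided by `H² S`, where `S = 1 + |H'| / H²`. -/
theorem tendsto_weylSq_div_ricciSq {G : Coord → Matrix (Fin 4) (Fin 4) ℝ} {τ : Coord → ℝ}
    {V : Set Coord} (hV : IsOpen V) {x₀ : Coord} (hx₀ : x₀ ∈ V)
    (hG : ∀ i j, ContDiffOn ℝ 2 (fun x => G x i j) V) (hsymm : ∀ x ∈ V, (G x).IsSymm)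
    (hdet : ∀ x ∈ V, (G x).det ≠ 0) (hτ : ContDiffOn ℝ 2 τ V)
    (hN : (fun i => pd i τ x₀) ⬝ᵥ (G x₀)⁻¹.mulVec (fun i => pd i τ x₀) ≠ 0)
    {Ω : ℝ → ℝ} {J : Set ℝ} (hJ : IsOpen J) (hΩ : ContDiffOn ℝ 2 Ω J) (hΩ0 : ∀ t ∈ J, Ω t ≠ 0)
    {l : Filter Coord} (hl : l ≤ 𝓝 x₀) (hlJ : ∀ᶠ x in l, τ x ∈ J)
    (hH : Tendsto (fun x => |logDeriv Ω (τ x)|) l atTop) :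
    (∀ᶠ x in l, ricciSq (fun y => Ω (τ y) ^ 2 • G y) x ≠ 0) ∧
      Tendsto (fun x => weylSq (fun y => Ω (τ y) ^ 2 • G y) x
        / ricciSq (fun y => Ω (τ y) ^ 2 • G y) x) l (𝓝 0) := by
  have hlV : ∀ᶠ x in l, x ∈ V := hl (hV.mem_nhds hx₀)
  have hcont : ∀ {f : Coord → ℝ}, ContinuousOn f V → Tendsto f l (𝓝 (f x₀)) := fun hf =>
    (hf.continuousAt (hV.mem_nhds hx₀)).tendsto.mono_left hl
  set H : Coord → ℝ := fun x => logDeriv Ω (τ x) with hHdef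
  set α : Coord → ℝ := fun x => deriv (logDeriv Ω) (τ x) / H x ^ 2 with hα
  set S : Coord → ℝ := fun x => 1 + |α x| with hS
  have hS1 : ∀ x, 1 ≤ S x := fun x => le_add_of_nonneg_right (abs_nonneg _)
  have hS0 : ∀ x, S x ≠ 0 := fun x => (zero_lt_one.trans_le (hS1 x)).ne'
  have hHne : ∀ᶠ x in l, H x ≠ 0 := (hH.eventually_gt_atTop 0).mono fun x hx => abs_pos.mp hx
  have hHinv : Tendsto (fun x => |H x|⁻¹) l (𝓝 0) := tendsto_inv_atTop_zero.comp hH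
  set ρ : Coord → Fin 4 → Fin 4 → Fin 4 → Fin 4 → ℝ := fun x a b c d =>
    (H x ^ 2 * S x)⁻¹ * riemannUp G a b c d x + (H x * S x)⁻¹ * linearRiemann G τ a b c d x
    with hρdef
  have hSinv : ∀ x, |(S x)⁻¹| ≤ 1 := fun x => by
    rw [abs_inv, abs_of_pos (zero_lt_one.trans_le (hS1 x))]
    exact inv_le_one_of_one_le₀ (hS1 x)
  have hk1 : Tendsto (fun x => (H x * S x)⁻¹) l (𝓝 0) := by
    refine squeeze_zero_norm (fun x => ?_) hHinv
    rw [mul_inv, norm_mul, Real.norm_eq_abs, Real.norm_eq_abs, abs_inv]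
    exact mul_le_of_le_one_right (by positivity) (hSinv x)
  have hk2 : Tendsto (fun x => (H x ^ 2 * S x)⁻¹) l (𝓝 0) := by
    have h2 : Tendsto (fun x => |H x|⁻¹ * |H x|⁻¹) l (𝓝 0) := by simpa using hHinv.mul hHinv
    refine squeeze_zero_norm (fun x => ?_) h2
    rw [mul_inv, norm_mul, Real.norm_eq_abs, Real.norm_eq_abs, sq, mul_inv, abs_mul, abs_inv]
    exact mul_le_of_le_one_right (by positivity) (hSinv x)
  have hρ : Tendsto ρ l (𝓝 0) := by
    simp only [tendsto_pi_nhds]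
    intro a b c d
    have := (hk2.mul (hcont (continuousOn_riemannUp hV hG hdet a b c d))).add
      (hk1.mul (hcont (continuousOn_linearRiemann hV hG hdet hτ a b c d)))
    rw [zero_mul, zero_mul, add_zero] at this
    exact this
  have hg : Tendsto G l (𝓝 (G x₀)) := by
    refine tendsto_pi_nhds.mpr fun i => tendsto_pi_nhds.mpr fun j => ?_
    exact hcont (hG i j).continuousOn
  have hh : Tendsto (fun x => (G x)⁻¹) l (𝓝 (G x₀)⁻¹) := by
    refine tendsto_pi_nhds.mpr fun i => tendsto_pi_nhds.mpr fun j => ?_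
    exact hcont (contDiffOn_inv hG hdet i j).continuousOn
  have hT : Tendsto (fun x i => pd i τ x) l (𝓝 fun i => pd i τ x₀) := by
    refine tendsto_pi_nhds.mpr fun i => hcont (continuousOn_pd hV (hτ.of_le (by norm_num)) i)
  have hpq : ∀ x, |α x / S x| + |1 / S x| = 1 := fun x => by
    rw [abs_div (α x), abs_div 1, abs_of_pos (zero_lt_one.trans_le (hS1 x)), abs_one, ← add_div,
      add_comm, div_self (hS0 x)]
  obtain ⟨hWeyl, m, hm, hRic⟩ := normalized_curvature_limits hg hh hT hρ
    (hlV.mono hsymm) (hlV.mono hdet) (Eventually.of_forall hpq) hN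
  set Rn : Coord → Fin 4 → Fin 4 → Fin 4 → Fin 4 → ℝ := fun x =>
    leadingRiemann (G x) (G x)⁻¹ (fun i => pd i τ x) (α x / S x) (1 / S x) + ρ x with hRn
  set k : Coord → ℝ := fun x => H x ^ 2 * S x with hk
  have hk0 : ∀ᶠ x in l, k x ≠ 0 := hHne.mono fun x hx => mul_ne_zero (pow_ne_zero 2 hx) (hS0 x)
  have hR : ∀ᶠ x in l, (fun a b c d => riemannUp (fun y => Ω (τ y) ^ 2 • G y) a b c d x)
      = k x • Rn x := by
    filter_upwards [hlV, hlJ, hHne] with x hx hxJ hxH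
    funext a b c d
    rw [riemannUp_conformal hV hG hdet hτ hJ hΩ hΩ0 hx hxJ]
    have hS0 := hS0 x
    simp only [hRn, hk, hρdef, Pi.smul_apply, Pi.add_apply, smul_eq_mul, leadingRiemann]
    have e1 : deriv (logDeriv Ω) (τ x) = α x * H x ^ 2 := by
      rw [hα]; field_simp
    rw [e1]
    change _ + H x * _ + (_ + H x ^ 2 * _) = _
    field_simp
    ring
  have hsq : ∀ᶠ x in l, ricciSq (fun y => Ω (τ y) ^ 2 • G y) x
        = ((Ω (τ x) ^ 2)⁻¹ * k x) ^ 2 * pairTwo (G x)⁻¹ (ricciOf (Rn x)) (ricciOf (Rn x)) ∧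
      weylSq (fun y => Ω (τ y) ^ 2 • G y) x
        = ((Ω (τ x) ^ 2)⁻¹ * k x) ^ 2 * sqFour (G x)⁻¹ (weylOf (G x) (G x)⁻¹ (Rn x)) := by
    filter_upwards [hlV, hlJ, hR] with x hx hxJ hxR
    exact curvature_squares_of_smul rfl (pow_ne_zero 2 (hΩ0 _ hxJ)) (hdet x hx) hxR
  have hc : ∀ᶠ x in l, ((Ω (τ x) ^ 2)⁻¹ * k x) ^ 2 ≠ 0 := by
    filter_upwards [hlJ, hk0] with x hxJ hxk
    exact pow_ne_zero 2 (mul_ne_zero (inv_ne_zero (pow_ne_zero 2 (hΩ0 _ hxJ))) hxk)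
  exact tendsto_div_of_common_factor hsq hc hm hRic hWeyl

/-! ### Growth of the logarithmic derivative of the conformal factor -/

lemma tendsto_zero_or_eventually_le {v : ℝ → ℝ} {a : ℝ} (ha : a < 0)
    (hv : MonotoneOn v (Ioo a 0) ∨ AntitoneOn v (Ioo a 0)) (hpos : ∀ t ∈ Ioo a 0, 0 < v t) :
    Tendsto v (𝓝[<] 0) (𝓝 0) ∨ ∃ ε > 0, ∀ᶠ t in 𝓝[<] (0 : ℝ), ε ≤ v t := by
  have hmem : ∀ {b : ℝ}, b < 0 → ∀ᶠ t in 𝓝[<] (0 : ℝ), t ∈ Ioo b 0 := fun hb =>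
    Ioo_mem_nhdsLT hb
  by_cases h : Tendsto v (𝓝[<] 0) (𝓝 0)
  · exact Or.inl h
  refine Or.inr ?_
  rcases hv with hv | hv
  · have hm : a / 2 ∈ Ioo a 0 := ⟨by linarith, by linarith⟩
    refine ⟨v (a / 2), hpos _ hm, ?_⟩
    filter_upwards [hmem hm.2] with t ht
    exact hv hm ⟨hm.1.trans ht.1, ht.2⟩ ht.1.le
  · rw [Metric.tendsto_nhds] at h
    push Not at h
    obtain ⟨ε, hε, hf⟩ := h
    refine ⟨ε, hε, ?_⟩
    filter_upwards [hmem ha] with t ht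
    obtain ⟨s, hs, hst⟩ := (hf.and_eventually (hmem ht.2)).exists
    have hs' : s ∈ Ioo a 0 := ⟨ht.1.trans hst.1, hst.2⟩
    rw [Real.dist_eq, sub_zero, abs_of_pos (hpos s hs')] at hs
    exact hs.trans (hv ht hs' hst.1.le)

lemma deriv_deriv_eq_zero_of_deriv_eq_zero {Ω : ℝ → ℝ} {a t : ℝ}
    (hmono : MonotoneOn Ω (Ioo a 0) ∨ AntitoneOn Ω (Ioo a 0)) (ht : t ∈ Ioo a 0)
    (h0 : deriv Ω t = 0) : deriv (deriv Ω) t = 0 := by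
  have hnear : Ioo a 0 ∈ 𝓝 t := isOpen_Ioo.mem_nhds ht
  rcases hmono with h | h
  · refine IsLocalMin.deriv_eq_zero ?_
    filter_upwards [hnear] with s hs
    rw [h0, ← derivWithin_of_mem_nhds (isOpen_Ioo.mem_nhds hs)]
    exact h.derivWithin_nonneg
  · refine IsLocalMax.deriv_eq_zero ?_
    filter_upwards [hnear] with s hs
    rw [h0, ← derivWithin_of_mem_nhds (isOpen_Ioo.mem_nhds hs)]
    exact h.derivWithin_nonpos

/-- If the ratio `Ω'' Ω / (Ω')²` is bounded near `0` then `Ω'` has no zeros there: by Grönwall's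
inequality `Ω'` would vanish identically to the right of such a zero. -/
lemma deriv_ne_zero_of_ratioL_bounded {Ω : ℝ → ℝ} {a B : ℝ}
    (hΩ : ContDiffOn ℝ 2 Ω (Ioo a 0)) (hpos : ∀ t ∈ Ioo a 0, 0 < Ω t)
    (hmono : StrictMonoOn Ω (Ioo a 0) ∨ StrictAntiOn Ω (Ioo a 0))
    (hL : ∀ t ∈ Ioo a 0, |ratioL Ω t| ≤ B) {t : ℝ} (ht : t ∈ Ioo a 0) : deriv Ω t ≠ 0 := by
  intro h0
  have hmono' : MonotoneOn Ω (Ioo a 0) ∨ AntitoneOn Ω (Ioo a 0) :=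
    hmono.imp StrictMonoOn.monotoneOn StrictAntiOn.antitoneOn
  have ht2 : t < t / 2 := by linarith [ht.2]
  have hsub : Icc t (t / 2) ⊆ Ioo a 0 := fun s hs => ⟨ht.1.trans_le hs.1, by linarith [hs.2, ht.2]⟩
  have hd : ContDiffOn ℝ 1 (deriv Ω) (Ioo a 0) := hΩ.deriv_of_isOpen isOpen_Ioo (by norm_num)
  have hquad : ∀ s ∈ Ioo a 0, |deriv (deriv Ω) s| ≤ B / Ω s * |deriv Ω s| * |deriv Ω s| := by
    intro s hs
    by_cases hs0 : deriv Ω s = 0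
    · simp [hs0, deriv_deriv_eq_zero_of_deriv_eq_zero hmono' hs hs0]
    · have h1 := hL s hs
      have hp := hpos s hs
      rw [ratioL, abs_div, abs_mul, abs_of_pos hp, abs_pow, div_le_iff₀ (by positivity)] at h1
      rw [div_mul_eq_mul_div, div_mul_eq_mul_div, le_div_iff₀ hp]
      linarith [sq |deriv Ω s|]
  -- on the compact interval the coefficient `B |Ω'| / Ω` is bounded
  have hcoef : ContinuousOn (fun s => B / Ω s * |deriv Ω s|) (Icc t (t / 2)) :=
    ((continuousOn_const.div hΩ.continuousOn fun s hs => (hpos s hs).ne').mul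
      hd.continuousOn.abs).mono hsub
  obtain ⟨K, hK⟩ := isCompact_Icc.bddAbove_image hcoef
  have hzero := eq_zero_of_abs_deriv_le_mul_abs_self_of_eq_zero_right (f' := deriv (deriv Ω))
    (K := K) (hd.continuousOn.mono hsub)
    (fun s hs => ((hd.contDiffAt (isOpen_Ioo.mem_nhds (hsub ⟨hs.1, hs.2.le⟩))).differentiableAt
      (by norm_num)).hasDerivAt.hasDerivWithinAt) h0
    (fun s hs => (hquad s (hsub ⟨hs.1, hs.2.le⟩)).trans
      (mul_le_mul_of_nonneg_right (hK (mem_image_of_mem _ ⟨hs.1, hs.2.le⟩)) (abs_nonneg _)))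
  have hconst : Ω (t / 2) = Ω t := by
    have hdiff : DifferentiableOn ℝ Ω (Icc t (t / 2)) :=
      (hΩ.differentiableOn (by norm_num)).mono hsub
    refine constant_of_derivWithin_zero hdiff (fun s hs => ?_) _ (right_mem_Icc.mpr ht2.le)
    have hs' : s ∈ Icc t (t / 2) := ⟨hs.1, hs.2.le⟩
    rw [DifferentiableAt.derivWithin
      ((hΩ.contDiffAt (isOpen_Ioo.mem_nhds (hsub hs'))).differentiableAt (by norm_num))
      (uniqueDiffOn_Icc ht2 s hs')]
    exact hzero s hs'
  have hm : t / 2 ∈ Ioo a 0 := hsub (right_mem_Icc.mpr ht2.le)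
  rcases hmono with h | h
  · exact (h ht hm ht2).ne' hconst
  · exact (h ht hm ht2).ne hconst

lemma ratioL_eq_zero_of_deriv_eq_zero {Ω : ℝ → ℝ} {t : ℝ} (h : deriv Ω t = 0) :
    ratioL Ω t = 0 := by
  simp [ratioL, h]

/-- Near `0` the derivative of the conformal factor has no zeros. Where it has one, `ratioL` takes
the value `0`, so this is clear unless the limit is `0`, and then `ratioL` is bounded. -/
lemma eventually_deriv_ne_zero {Ω : ℝ → ℝ} {a : ℝ} {lam : EReal} (ha : a < 0)
    (hΩ : ContDiffOn ℝ 2 Ω (Ioo a 0)) (hpos : ∀ t ∈ Ioo a 0, 0 < Ω t)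
    (hmono : StrictMonoOn Ω (Ioo a 0) ∨ StrictAntiOn Ω (Ioo a 0))
    (hL : Tendsto (fun t => (ratioL Ω t : EReal)) (𝓝[<] 0) (𝓝 lam)) :
    ∀ᶠ t in 𝓝[<] (0 : ℝ), deriv Ω t ≠ 0 := by
  by_cases hlam : lam = 0
  · have hL0 : Tendsto (ratioL Ω) (𝓝[<] 0) (𝓝 0) := by
      rw [hlam, ← EReal.coe_zero] at hL
      exact EReal.tendsto_coe.mp hL
    have h1 : ∀ᶠ t in 𝓝[<] (0 : ℝ), |ratioL Ω t| ≤ 1 := by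
      filter_upwards [hL0.abs.eventually (gt_mem_nhds (show |(0 : ℝ)| < 1 by simp))] with t ht
      exact ht.le
    obtain ⟨b, hb, hb1⟩ := (mem_nhdsLT_iff_exists_Ioo_subset' ha).mp h1
    have hsub : Ioo (max a b) 0 ⊆ Ioo a 0 := Ioo_subset_Ioo_left (le_max_left _ _)
    filter_upwards [Ioo_mem_nhdsLT (max_lt ha hb)] with t ht
    exact deriv_ne_zero_of_ratioL_bounded (hΩ.mono hsub) (fun s hs => hpos s (hsub hs))
      (hmono.imp (fun h => h.mono hsub) fun h => h.mono hsub)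
      (fun s hs => hb1 ⟨(le_max_right a b).trans_lt hs.1, hs.2⟩) ht
  · filter_upwards [hL.eventually_ne hlam] with t ht h0
    exact ht (by simp [ratioL_eq_zero_of_deriv_eq_zero h0])

/-- If the logarithmic derivative of `Ω` is bounded near `0` then so is `log Ω`, by the mean value
inequality. -/
lemma not_tendsto_abs_log_of_bounded {Ω : ℝ → ℝ} {a ε : ℝ} (ha : a < 0)
    (hd : ∀ t ∈ Ioo a 0, DifferentiableAt ℝ Ω t) (hpos : ∀ t ∈ Ioo a 0, 0 < Ω t)
    (hb : ∀ᶠ t in 𝓝[<] (0 : ℝ), |logDeriv Ω t| ≤ ε) :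
    ¬ Tendsto (fun t => |Real.log (Ω t)|) (𝓝[<] 0) atTop := by
  intro hlog
  obtain ⟨b, hb0, hb1⟩ := (mem_nhdsLT_iff_exists_Ioo_subset' ha).mp hb
  set c := max a b with hc
  have hc0 : c < 0 := max_lt ha hb0
  have hsub : Ioo c 0 ⊆ Ioo a 0 := Ioo_subset_Ioo_left (le_max_left _ _)
  have hm : c / 2 ∈ Ioo c 0 := ⟨by linarith, by linarith⟩
  have hbound : ∀ t ∈ Ioo c 0, |Real.log (Ω t)| ≤ |Real.log (Ω (c / 2))| + ε * |c| := by
    intro t ht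
    have h := (convex_Ioo c 0).norm_image_sub_le_of_norm_hasDerivWithin_le
      (f := fun t => Real.log (Ω t)) (f' := logDeriv Ω) (C := ε)
      (fun s hs => ((hd s (hsub hs)).hasDerivAt.log (hpos s (hsub hs)).ne').hasDerivWithinAt)
      (fun s hs => hb1 ⟨(le_max_right a b).trans_lt hs.1, hs.2⟩) hm ht
    rw [Real.norm_eq_abs, Real.norm_eq_abs] at h
    have hε : 0 ≤ ε :=
      (abs_nonneg _).trans (hb1 ⟨(le_max_right a b).trans_lt hm.1, hm.2⟩)
    have h2 : |t - c / 2| ≤ |c| := by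
      rw [abs_of_neg hc0, abs_le]
      constructor <;> linarith [ht.1, ht.2]
    have h3 := abs_sub_abs_le_abs_sub (Real.log (Ω t)) (Real.log (Ω (c / 2)))
    linarith [mul_le_mul_of_nonneg_left h2 hε]
  obtain ⟨t, ht, ht1⟩ := ((hlog.eventually_gt_atTop _).and (Ioo_mem_nhdsLT hc0)).exists
  exact (hbound t ht1).not_gt ht

/-- The reciprocal `Ω / Ω'` of the logarithmic derivative has derivative `1 - L`, which has a
constant sign near `0`. Hence it is monotone; it must tend to zero, as otherwise `log Ω` would
be bounded. -/
lemma tendsto_abs_logDeriv {Ω : ℝ → ℝ} {a : ℝ} {lam : EReal} (ha : a < 0)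
    (hΩ : ContDiffOn ℝ 2 Ω (Ioo a 0)) (hpos : ∀ t ∈ Ioo a 0, 0 < Ω t)
    (hmono : StrictMonoOn Ω (Ioo a 0) ∨ StrictAntiOn Ω (Ioo a 0))
    (hL : Tendsto (fun t => (ratioL Ω t : EReal)) (𝓝[<] 0) (𝓝 lam)) (hlam : lam ≠ 1)
    (hlog : Tendsto (fun t => |Real.log (Ω t)|) (𝓝[<] 0) atTop) :
    Tendsto (fun t => |logDeriv Ω t|) (𝓝[<] 0) atTop := by
  have hgood : ∀ᶠ t in 𝓝[<] (0 : ℝ), t ∈ Ioo a 0 ∧ deriv Ω t ≠ 0 :=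
    (show ∀ᶠ t in 𝓝[<] (0 : ℝ), t ∈ Ioo a 0 from Ioo_mem_nhdsLT ha).and
      (eventually_deriv_ne_zero ha hΩ hpos hmono hL)
  obtain ⟨b, hb0, hbd, hbL⟩ : ∃ b < 0, (∀ t ∈ Ioo b 0, t ∈ Ioo a 0 ∧ deriv Ω t ≠ 0) ∧
      ((∀ t ∈ Ioo b 0, ratioL Ω t ≤ 1) ∨ ∀ t ∈ Ioo b 0, 1 ≤ ratioL Ω t) := by
    rcases lt_or_gt_of_ne hlam with h | h
    · obtain ⟨b, hb0, hb⟩ := (mem_nhdsLT_iff_exists_Ioo_subset' ha).mp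
        (hgood.and (hL.eventually (gt_mem_nhds h)))
      exact ⟨b, hb0, fun t ht => (hb ht).1, Or.inl fun t ht => by exact_mod_cast (hb ht).2.le⟩
    · obtain ⟨b, hb0, hb⟩ := (mem_nhdsLT_iff_exists_Ioo_subset' ha).mp
        (hgood.and (hL.eventually (lt_mem_nhds h)))
      exact ⟨b, hb0, fun t ht => (hb ht).1, Or.inr fun t ht => by exact_mod_cast (hb ht).2.le⟩
  set w : ℝ → ℝ := fun t => Ω t / deriv Ω t with hw
  have hd : ContDiffOn ℝ 1 (deriv Ω) (Ioo a 0) := hΩ.deriv_of_isOpen isOpen_Ioo (by norm_num)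
  have hwd : ∀ t ∈ Ioo b 0, HasDerivAt w (1 - ratioL Ω t) t := fun t ht => by
    have hn := isOpen_Ioo.mem_nhds (hbd t ht).1
    have h1 := ((hΩ.contDiffAt hn).differentiableAt (by norm_num)).hasDerivAt
    have h2 := ((hd.contDiffAt hn).differentiableAt (by norm_num)).hasDerivAt
    have h3 := (hbd t ht).2
    refine (h1.fun_div h2 h3).congr_deriv ?_
    rw [ratioL]
    field_simp
  have hwcont : ContinuousOn w (Ioo b 0) := fun t ht => (hwd t ht).continuousAt.continuousWithinAt
  have hwdiff : DifferentiableOn ℝ w (interior (Ioo b 0)) := fun t ht =>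
    (hwd t (interior_subset ht)).differentiableAt.differentiableWithinAt
  have hwmono : MonotoneOn w (Ioo b 0) ∨ AntitoneOn w (Ioo b 0) := by
    refine hbL.imp (fun h => ?_) fun h => ?_
    · refine monotoneOn_of_deriv_nonneg (convex_Ioo b 0) hwcont hwdiff fun t ht => ?_
      rw [(hwd t (interior_subset ht)).deriv]
      linarith [h t (interior_subset ht)]
    · refine antitoneOn_of_deriv_nonpos (convex_Ioo b 0) hwcont hwdiff fun t ht => ?_
      rw [(hwd t (interior_subset ht)).deriv]
      linarith [h t (interior_subset ht)]
  have hv : MonotoneOn (fun t => |w t|) (Ioo b 0) ∨ AntitoneOn (fun t => |w t|) (Ioo b 0) := by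
    have hderiv : ∀ t ∈ Ioo b 0, derivWithin Ω (Ioo a 0) t = deriv Ω t := fun t ht =>
      derivWithin_of_mem_nhds (isOpen_Ioo.mem_nhds (hbd t ht).1)
    rcases hmono with hm | hm
    · have habs : EqOn w (fun t => |w t|) (Ioo b 0) := fun t ht =>
        (abs_of_nonneg (div_nonneg (hpos t (hbd t ht).1).le
          (hderiv t ht ▸ hm.monotoneOn.derivWithin_nonneg))).symm
      exact hwmono.imp (fun h => h.congr habs) fun h => h.congr habs
    · have habs : EqOn (-w) (fun t => |w t|) (Ioo b 0) := fun t ht =>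
        (abs_of_nonpos (div_nonpos_of_nonneg_of_nonpos (hpos t (hbd t ht).1).le
          (hderiv t ht ▸ hm.antitoneOn.derivWithin_nonpos))).symm
      exact hwmono.symm.imp (fun h => h.neg.congr habs) fun h => h.neg.congr habs
  have hvpos : ∀ t ∈ Ioo b 0, 0 < |w t| := fun t ht =>
    abs_pos.mpr (div_ne_zero (hpos t (hbd t ht).1).ne' (hbd t ht).2)
  have hinv : ∀ t, |logDeriv Ω t| = |w t|⁻¹ := fun t => by
    rw [hw, ← abs_inv, inv_div, logDeriv_apply]
  rcases tendsto_zero_or_eventually_le hb0 hv hvpos with h | ⟨ε, hε, h⟩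
  · have hpos' : ∀ᶠ t in 𝓝[<] (0 : ℝ), |w t| ∈ Ioi 0 := by
      filter_upwards [Ioo_mem_nhdsLT hb0] with t ht
      exact hvpos t ht
    have := tendsto_inv_nhdsGT_zero.comp (tendsto_nhdsWithin_iff.mpr ⟨h, hpos'⟩)
    exact this.congr fun t => (hinv t).symm
  · refine absurd hlog (not_tendsto_abs_log_of_bounded (ε := ε⁻¹) ha
      (fun t ht => (hΩ.contDiffAt (isOpen_Ioo.mem_nhds ht)).differentiableAt (by norm_num)) hpos ?_)
    filter_upwards [h] with t ht
    rw [hinv]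
    exact inv_anti₀ hε ht

/-- The common content of the four conditions on the conformal factor, on the side `t < 0`. -/
lemma growth_from_below {Ω : ℝ → ℝ} {lam : EReal} (hlam : lam ≠ 1)
    (hΩ : DivergesFromBelow Ω ∨ VanishesFromBelow Ω)
    (hL : Tendsto (fun t => (ratioL Ω t : EReal)) (𝓝[<] 0) (𝓝 lam)) :
    ∃ J ∈ 𝓝[<] (0 : ℝ), IsOpen J ∧ ContDiffOn ℝ 2 Ω J ∧ (∀ t ∈ J, Ω t ≠ 0) ∧
      Tendsto (fun t => |logDeriv Ω t|) (𝓝[<] 0) atTop := by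
  obtain ⟨c, hc, hpos, hsmooth, hmono, hlog⟩ : ∃ c : ℝ, 0 < c ∧ (∀ t ∈ Ico (-c) 0, 0 < Ω t) ∧
      ContDiffOn ℝ 2 Ω (Ico (-c) 0) ∧
      (StrictMonoOn Ω (Ico (-c) 0) ∨ StrictAntiOn Ω (Ico (-c) 0)) ∧
      Tendsto (fun t => |Real.log (Ω t)|) (𝓝[<] 0) atTop := by
    rcases hΩ with ⟨hlim, c, hc, hpos, hsmooth, hmono⟩ | ⟨h0, c, hc, hpos, hsmooth, hmono, hcont⟩
    · exact ⟨c, hc, hpos, hsmooth, Or.inl hmono,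
        tendsto_abs_atTop_atTop.comp (Real.tendsto_log_atTop.comp hlim)⟩
    · refine ⟨c, hc, hpos, hsmooth, Or.inr hmono, ?_⟩
      have hlim : Tendsto Ω (𝓝[<] 0) (𝓝[>] 0) := by
        have hev : ∀ᶠ t in 𝓝[<] (0 : ℝ), t ∈ Ioo (-c) 0 := Ioo_mem_nhdsLT (neg_lt_zero.mpr hc)
        refine tendsto_nhdsWithin_iff.mpr ⟨?_, hev.mono fun t ht => hpos t ⟨ht.1.le, ht.2⟩⟩
        have h1 : Tendsto Ω (𝓝[Icc (-c) 0] 0) (𝓝 0) := by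
          have := (hcont 0 ⟨(neg_lt_zero.mpr hc).le, le_rfl⟩).tendsto
          rwa [h0] at this
        exact h1.mono_left (nhdsWithin_le_of_mem (hev.mono fun t ht => ⟨ht.1.le, ht.2.le⟩))
      exact tendsto_abs_atBot_atTop.comp (Real.tendsto_log_nhdsGT_zero.comp hlim)
  have hc' := neg_lt_zero.mpr hc
  have hsub : Ioo (-c) 0 ⊆ Ico (-c) 0 := Ioo_subset_Ico_self
  exact ⟨Ioo (-c) 0, Ioo_mem_nhdsLT hc', isOpen_Ioo, hsmooth.mono hsub,
    fun t ht => (hpos t (hsub ht)).ne',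
    tendsto_abs_logDeriv hc' (hsmooth.mono hsub) (fun t ht => hpos t (hsub ht))
      (hmono.imp (fun h => h.mono hsub) fun h => h.mono hsub) hL hlam hlog⟩

lemma deriv_reflect (f : ℝ → ℝ) : deriv (fun t => f (-t)) = fun t => -deriv f (-t) :=
  funext fun t => deriv_comp_neg f t

lemma ratioL_reflect (Ω : ℝ → ℝ) (t : ℝ) : ratioL (fun s => Ω (-s)) t = ratioL Ω (-t) := by
  have h2 : deriv (deriv fun s => Ω (-s)) t = deriv (deriv Ω) (-t) := by
    rw [deriv_reflect Ω, deriv.fun_neg, congrFun (deriv_reflect (deriv Ω)) t, neg_neg]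
  rw [ratioL, ratioL, h2, deriv_reflect Ω, neg_sq]

lemma logDeriv_reflect (Ω : ℝ → ℝ) (t : ℝ) :
    logDeriv (fun s => Ω (-s)) t = -logDeriv Ω (-t) := by
  rw [logDeriv_apply, logDeriv_apply, deriv_reflect Ω, neg_div]

lemma tendsto_neg_nhdsLT_zero : Tendsto (fun t : ℝ => -t) (𝓝[<] 0) (𝓝[>] 0) := by
  simpa using tendsto_neg_nhdsLT (a := (0 : ℝ))

lemma tendsto_neg_nhdsGT_zero : Tendsto (fun t : ℝ => -t) (𝓝[>] 0) (𝓝[<] 0) := by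
  simpa using tendsto_neg_nhdsGT (a := (0 : ℝ))

/-- The common content of the four conditions on the conformal factor, on the side `t > 0`,
obtained from the other side by the reflection `t ↦ -t`. -/
lemma growth_from_above {Ω : ℝ → ℝ} {lam : EReal} (hlam : lam ≠ 1)
    (hΩ : DivergesFromAbove Ω ∨ VanishesFromAbove Ω)
    (hL : Tendsto (fun t => (ratioL Ω t : EReal)) (𝓝[>] 0) (𝓝 lam)) :
    ∃ J ∈ 𝓝[>] (0 : ℝ), IsOpen J ∧ ContDiffOn ℝ 2 Ω J ∧ (∀ t ∈ J, Ω t ≠ 0) ∧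
      Tendsto (fun t => |logDeriv Ω t|) (𝓝[>] 0) atTop := by
  have hneg : ∀ {c : ℝ}, MapsTo (fun t : ℝ => -t) (Ico (-c) 0) (Ioc 0 c) := @fun c t ht =>
    ⟨neg_pos.mpr ht.2, neg_le.mp ht.1⟩
  have hΩ' : DivergesFromBelow (fun t => Ω (-t)) ∨ VanishesFromBelow (fun t => Ω (-t)) := by
    refine hΩ.imp ?_ ?_
    · rintro ⟨hlim, c, hc, hpos, hsmooth, hmono⟩
      exact ⟨hlim.comp tendsto_neg_nhdsLT_zero, c, hc, fun t ht => hpos _ (hneg ht),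
        hsmooth.comp contDiff_neg.contDiffOn hneg,
        fun s hs t ht hst => hmono (hneg ht) (hneg hs) (neg_lt_neg hst)⟩
    · rintro ⟨h0, c, hc, hpos, hsmooth, hmono, hcont⟩
      exact ⟨by simpa using h0, c, hc, fun t ht => hpos _ (hneg ht),
        hsmooth.comp contDiff_neg.contDiffOn hneg,
        fun s hs t ht hst => hmono (hneg ht) (hneg hs) (neg_lt_neg hst),
        hcont.comp continuous_neg.continuousOn fun t ht => ⟨neg_nonneg.mpr ht.2, neg_le.mp ht.1⟩⟩
  have hL' : Tendsto (fun t => (ratioL (fun s => Ω (-s)) t : EReal)) (𝓝[<] 0) (𝓝 lam) := by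
    simp only [ratioL_reflect]
    exact hL.comp tendsto_neg_nhdsLT_zero
  obtain ⟨J, hJ0, hJ, hsmooth, hne, hlog⟩ := growth_from_below hlam hΩ' hL'
  refine ⟨(fun t => -t) ⁻¹' J, tendsto_neg_nhdsGT_zero hJ0, hJ.preimage continuous_neg, ?_,
    fun t ht => by simpa using hne (-t) ht, ?_⟩
  · have := hsmooth.comp (t := J) (s := (fun t => -t) ⁻¹' J) contDiff_neg.contDiffOn fun t ht => ht
    simpa [Function.comp_def] using this
  · have := hlog.comp tendsto_neg_nhdsGT_zero
    refine this.congr fun t => ?_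
    rw [Function.comp_apply, logDeriv_reflect, neg_neg, abs_neg]

/-! ### Tensor fields in a chart -/

section Chart

variable {M : Type*} [TopologicalSpace M] [ChartedSpace Coord M]

lemma components_conformalRescaling (Ω : ℝ → ℝ) (T : M → ℝ) (g : BilinField M)
    (φ : OpenPartialHomeomorph M Coord) :
    components (conformalRescaling Ω T g) φ
      = fun x => Ω (T (φ.symm x)) ^ 2 • components g φ x := by
  funext x
  ext i j
  simp [components, conformalRescaling]

lemma sum_smul_coordDir (v : Fin 4 → ℝ) : ∑ i, v i • coordDir i = WithLp.toLp 2 v := by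
  ext j
  simp [coordDir, Pi.single_apply]

variable {φ : OpenPartialHomeomorph M Coord}

lemma mdifferentiable_of_mem_maximalAtlas (hφ : φ ∈ IsManifold.maximalAtlas (𝓡 4) ∞ M) :
    φ.MDifferentiable (𝓡 4) (𝓡 4) :=
  ⟨(contMDiffOn_of_mem_maximalAtlas hφ).mdifferentiableOn (by simp),
    (contMDiffOn_symm_of_mem_maximalAtlas hφ).mdifferentiableOn (by simp)⟩

lemma contDiffOn_comp_symm (hφ : φ ∈ IsManifold.maximalAtlas (𝓡 4) ∞ M) {T : M → ℝ}
    (hT : ContMDiff (𝓡 4) 𝓘(ℝ, ℝ) ∞ T) : ContDiffOn ℝ ∞ (fun x => T (φ.symm x)) φ.target :=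
  (hT.comp_contMDiffOn (contMDiffOn_symm_of_mem_maximalAtlas hφ)).contDiffOn

lemma sum_sum_mul_coordDir (B : Coord →L[ℝ] Coord →L[ℝ] ℝ) (u v : Fin 4 → ℝ) :
    u ⬝ᵥ (Matrix.of fun i j => B (coordDir i) (coordDir j)).mulVec v
      = B (WithLp.toLp 2 u) (WithLp.toLp 2 v) := by
  rw [← sum_smul_coordDir u, ← sum_smul_coordDir v]
  simp only [map_sum, map_smul, sum_apply, smul_apply,
    smul_eq_mul, dotProduct, Matrix.mulVec, Matrix.of_apply, Finset.mul_sum]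
  rw [Finset.sum_comm]
  exact Finset.sum_congr rfl fun i _ => Finset.sum_congr rfl fun j _ => by ring

/-- The components of a tensor field represent it in the basis of coordinate vectors. -/
lemma dotProduct_components_mulVec (g : BilinField M) (φ : OpenPartialHomeomorph M Coord)
    (x : Coord) (u v : Fin 4 → ℝ) :
    u ⬝ᵥ (components g φ x).mulVec v
      = g (φ.symm x) (mfderiv (𝓡 4) (𝓡 4) φ.symm x (WithLp.toLp 2 u))
          (mfderiv (𝓡 4) (𝓡 4) φ.symm x (WithLp.toLp 2 v)) := by
  let D : Coord →L[ℝ] Coord := mfderiv (𝓡 4) (𝓡 4) φ.symm x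
  let b : Coord →L[ℝ] Coord →L[ℝ] ℝ := g (φ.symm x)
  exact sum_sum_mul_coordDir (b.bilinearComp D D) u v

lemma mfderiv_symm_bijective (hφ : φ ∈ IsManifold.maximalAtlas (𝓡 4) ∞ M) {x : Coord}
    (hx : x ∈ φ.target) : Function.Bijective (mfderiv (𝓡 4) (𝓡 4) φ.symm x) :=
  (mdifferentiable_of_mem_maximalAtlas hφ).symm.mfderiv_bijective hx

lemma pd_comp_symm (hφ : φ ∈ IsManifold.maximalAtlas (𝓡 4) ∞ M) {T : M → ℝ}
    (hT : ContMDiff (𝓡 4) 𝓘(ℝ, ℝ) ∞ T) {x : Coord} (hx : x ∈ φ.target) (i : Fin 4) :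
    pd i (fun x => T (φ.symm x)) x
      = mfderiv (𝓡 4) 𝓘(ℝ, ℝ) T (φ.symm x) (mfderiv (𝓡 4) (𝓡 4) φ.symm x (coordDir i)) := by
  have h := mfderiv_comp x
    (hT.mdifferentiableAt (by simp) : MDifferentiableAt (𝓡 4) 𝓘(ℝ, ℝ) T (φ.symm x))
    ((mdifferentiable_of_mem_maximalAtlas hφ).mdifferentiableAt_symm hx)
  rw [mfderiv_eq_fderiv] at h
  exact DFunLike.congr_fun h (coordDir i)

variable [IsManifold (𝓡 4) ∞ M]

lemma SpacetimeMetric.components_isSymm (g : SpacetimeMetric M)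
    (φ : OpenPartialHomeomorph M Coord) (x : Coord) : (components g.val φ x).IsSymm :=
  Matrix.IsSymm.ext fun _ _ => g.symm _ _ _

lemma SpacetimeMetric.eq_zero_of_forall (g : SpacetimeMetric M) {p : M}
    {v : TangentSpace (𝓡 4) p} (hv : ∀ w, g.val p w v = 0) : v = 0 := by
  obtain ⟨e, he⟩ := g.lorentzian p
  refine e.ext_elem fun i => ?_
  have h1 : g.val p (e i) v = e.repr v i * (if i = 0 then -1 else 1) := by
    conv_lhs => rw [← e.sum_repr v]
    rw [map_sum, Finset.sum_eq_single i]
    · rw [map_smul, he, if_pos rfl, smul_eq_mul]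
    · intro j _ hj
      rw [map_smul, he, if_neg hj.symm, smul_zero]
    · simp
  rw [hv] at h1
  have h2 : (if i = 0 then (-1 : ℝ) else 1) ≠ 0 := by split_ifs <;> norm_num
  rw [map_zero]
  exact (mul_eq_zero.mp h1.symm).resolve_right h2

lemma SpacetimeMetric.det_components_ne_zero (g : SpacetimeMetric M)
    (hφ : φ ∈ IsManifold.maximalAtlas (𝓡 4) ∞ M) {x : Coord} (hx : x ∈ φ.target) :
    (components g.val φ x).det ≠ 0 := by
  intro hdet
  obtain ⟨v, hv0, hv⟩ := Matrix.exists_mulVec_eq_zero_iff.mpr hdet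
  obtain ⟨hinj, hsurj⟩ := mfderiv_symm_bijective hφ hx
  refine hv0 ?_
  have hD : mfderiv (𝓡 4) (𝓡 4) φ.symm x (WithLp.toLp 2 v) = 0 := by
    refine g.eq_zero_of_forall fun w => ?_
    obtain ⟨u, rfl⟩ := hsurj w
    refine (dotProduct_components_mulVec g.val φ x (WithLp.ofLp (p := 2) u) v).symm.trans ?_
    rw [hv, dotProduct_zero]
  have := hinj (hD.trans (map_zero _).symm)
  exact congrArg (fun z : Coord => z.ofLp) this

/-- The gradient of a cosmic time function is timelike, hence not null, in coordinates. -/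
lemma IsCosmicTime.gradient_sq_ne_zero {g : SpacetimeMetric M} {T : M → ℝ}
    (hT : IsCosmicTime g T) (hφ : φ ∈ IsManifold.maximalAtlas (𝓡 4) ∞ M) {x : Coord}
    (hx : x ∈ φ.target) :
    (fun i => pd i (fun x => T (φ.symm x)) x) ⬝ᵥ (components g.val φ x)⁻¹.mulVec
      (fun i => pd i (fun x => T (φ.symm x)) x) ≠ 0 := by
  obtain ⟨n, hn, hneg⟩ := hT.timelike_gradient (φ.symm x)
  obtain ⟨ν, rfl⟩ := (mfderiv_symm_bijective hφ hx).2 n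
  have hgrad : (components g.val φ x).mulVec (WithLp.ofLp (p := 2) ν)
      = fun i => pd i (fun x => T (φ.symm x)) x := by
    funext i
    rw [pd_comp_symm hφ hT.smooth hx, ← hn, g.symm, ← single_one_dotProduct i (Matrix.mulVec _ _)]
    exact dotProduct_components_mulVec g.val φ x _ _
  rw [← hgrad, Matrix.mulVec_mulVec, Matrix.nonsing_inv_mul _
    (isUnit_iff_ne_zero.mpr (g.det_components_ne_zero hφ hx)), Matrix.one_mulVec]
  rw [dotProduct_comm]
  exact ((dotProduct_components_mulVec g.val φ x _ _).trans_lt hneg).ne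

/-- The limit of `K` at a point of the slice, along the side `T ∈ s` of it, for a conformal factor
whose logarithmic derivative blows up on that side. -/
lemma kTendsToZero_of_growth {g : SpacetimeMetric M} {T : M → ℝ} (hT : IsCosmicTime g T)
    {U : Set M} (hU : IsOpen U) (hgU : IsCkOn 2 g.val U) {Ω : ℝ → ℝ} {s J : Set ℝ}
    (hJs : J ∈ 𝓝[s] (0 : ℝ)) (hJ : IsOpen J) (hΩ : ContDiffOn ℝ 2 Ω J) (hΩ0 : ∀ t ∈ J, Ω t ≠ 0)
    (hlog : Tendsto (fun t => |logDeriv Ω t|) (𝓝[s] 0) atTop) {p₀ : M} (hp₀ : T p₀ = 0)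
    (hp₀U : p₀ ∈ U) (hφ : φ ∈ IsManifold.maximalAtlas (𝓡 4) ∞ M) (hp₀φ : p₀ ∈ φ.source) :
    KTendsToZero (conformalRescaling Ω T g.val) φ (𝓝[T ⁻¹' s] p₀) := by
  have hTlim : Tendsto T (𝓝[T ⁻¹' s] p₀) (𝓝[s] 0) := by
    refine tendsto_nhdsWithin_iff.mpr ⟨?_, eventually_mem_nhdsWithin⟩
    rw [← hp₀]
    exact hT.smooth.continuous.continuousAt.tendsto.mono_left nhdsWithin_le_nhds
  have hφlim : Tendsto φ (𝓝[T ⁻¹' s] p₀) (𝓝 (φ p₀)) :=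
    (φ.continuousAt hp₀φ).tendsto.mono_left nhdsWithin_le_nhds
  have hback : ∀ᶠ p in 𝓝[T ⁻¹' s] p₀, φ.symm (φ p) = p :=
    nhdsWithin_le_nhds (φ.eventually_left_inverse hp₀φ)
  have hTφ : Tendsto (fun p => T (φ.symm (φ p))) (𝓝[T ⁻¹' s] p₀) (𝓝[s] 0) :=
    hTlim.congr' (hback.mono fun p hp => (congrArg T hp).symm)
  have hx₀ : φ p₀ ∈ φ.target ∩ φ.symm ⁻¹' U :=
    ⟨φ.map_source hp₀φ, by rwa [mem_preimage, φ.left_inv hp₀φ]⟩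
  have key := tendsto_weylSq_div_ricciSq (G := components g.val φ)
    (τ := fun x => T (φ.symm x)) (l := map φ (𝓝[T ⁻¹' s] p₀))
    (φ.isOpen_inter_preimage_symm hU) hx₀ (hgU φ hφ)
    (fun x _ => g.components_isSymm φ x) (fun x hx => g.det_components_ne_zero hφ hx.1)
    (((contDiffOn_comp_symm hφ hT.smooth).of_le (WithTop.coe_le_coe.mpr le_top)).mono inter_subset_left)
    (hT.gradient_sq_ne_zero hφ hx₀.1) hJ hΩ hΩ0 hφlim (hTφ hJs) (hlog.comp hTφ)
  rw [← components_conformalRescaling] at key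
  exact key

end Chart

end ConformalCosmology

end

theorem theoremK {M : Type*} [TopologicalSpace M] [ChartedSpace ConformalCosmology.Coord M]
    [IsManifold (𝓡 4) ∞ M] (g : ConformalCosmology.SpacetimeMetric M) (T : M → ℝ)
    (hT : ConformalCosmology.IsCosmicTime g T)
    (hg : ∃ U : Set M, IsOpen U ∧ {p | T p = 0} ⊆ U ∧ ConformalCosmology.IsCkOn 2 g.val U)
    (Ω : ℝ → ℝ) (lam : EReal) (hlam : lam ≠ 1) :
    ((ConformalCosmology.DivergesFromBelow Ω ∨ ConformalCosmology.VanishesFromBelow Ω) →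
      Tendsto (fun t => (ConformalCosmology.ratioL Ω t : EReal)) (𝓝[<] 0) (𝓝 lam) →
      ∀ p₀ : M, T p₀ = 0 → ∀ φ ∈ IsManifold.maximalAtlas (𝓡 4) ∞ M, p₀ ∈ φ.source →
        ConformalCosmology.KTendsToZero (ConformalCosmology.conformalRescaling Ω T g.val) φ
          (𝓝[{p | T p < 0}] p₀)) ∧
    ((ConformalCosmology.DivergesFromAbove Ω ∨ ConformalCosmology.VanishesFromAbove Ω) →
      Tendsto (fun t => (ConformalCosmology.ratioL Ω t : EReal)) (𝓝[>] 0) (𝓝 lam) →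
      ∀ p₀ : M, T p₀ = 0 → ∀ φ ∈ IsManifold.maximalAtlas (𝓡 4) ∞ M, p₀ ∈ φ.source →
        ConformalCosmology.KTendsToZero (ConformalCosmology.conformalRescaling Ω T g.val) φ
          (𝓝[{p | 0 < T p}] p₀)) := by
  obtain ⟨U, hU, hslice, hgU⟩ := hg
  refine ⟨fun hΩ hL p₀ hp₀ φ hφ hp₀φ => ?_, fun hΩ hL p₀ hp₀ φ hφ hp₀φ => ?_⟩
  · obtain ⟨J, hJs, hJ, hsmooth, hne, hlog⟩ := ConformalCosmology.growth_from_below hlam hΩ hL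
    exact ConformalCosmology.kTendsToZero_of_growth hT hU hgU hJs hJ hsmooth hne hlog hp₀
      (hslice hp₀) hφ hp₀φ
  · obtain ⟨J, hJs, hJ, hsmooth, hne, hlog⟩ := ConformalCosmology.growth_from_above hlam hΩ hL
    exact ConformalCosmology.kTendsToZero_of_growth hT hU hgU hJs hJ hsmooth hne hlog hp₀
      (hslice hp₀) hφ hp₀φ
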